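/- **Setting.** Let $X$ be a smooth projective geometrically connected curve over a finite field $\mathbb F_r$ of characteristic $p$, with function field $\mathbf k$, let $\infty$ be a closed point of $X$ and $\mathbf A$ the affine ring of $X\setminus\infty$. Let $\mathbf K=\mathbf k_\infty$, let $\mathbf C_\infty$ be the completion of an algebraic closure of $\mathbf K$, and let $\mathbb F_\infty\subset\mathbf K$ be the field of constants, of degree $d_\infty$ over $\mathbb F_r$. Fix a sign function $\mathrm{sgn}\colon\mathbf K^\ast\to\mathbb F_\infty^\ast$ (a homomorphism that is the identity on $\mathbb F_\infty^\ast$) and a uniformizer $\pi$ of $\mathbf K$ with $\mathrm{sgn}(\pi)=1$. An element of sign $1$ is called positive. For positive $z\in\mathbf K^\ast$ put $\langle z\rangle=\pi^{-v_\infty(z)}z$, where $v_\infty(\pi)=1$. Let $e$ be the index of the group of principal, positively generated fractional ideals in the group of all fractional ideals of $\mathbf A$. For a fractional ideal $I$ write $I^e=(i)$ with $i$ positive, and let $\langle I\rangle\in\mathbf C_\infty$ be the unique $1$-unit with $\langle I\rangle^e=\langle i\rangle$. For a nonzero ideal $I$ of $\mathbf A$ let $\deg I=\dim_{\mathbb F_r}\mathbf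 A/I$. A $1$-unit $u$ is raised to powers $y\in\mathbb Z_p$ by $u^y=\lim u^n$, for natural numbers $n\to y$ $p$-adically. **The place $\infty$.** Let $c(I)$, for $I$ a nonzero ideal of $\mathbf A$, be elements of a finite extension of $\mathbf K$ in $\mathbf C_\infty$, and suppose that for each $y\in\mathbb Z_p$ the power series in $x^{-1}$ $$L(x,y)=\sum_{I}c(I)\,x^{-\deg I}\langle I\rangle^{-y}=\sum_{d\ge0}\Big(\sum_{\deg I=d}c(I)\langle I\rangle^{-y}\Big)x^{-d}$$ is entire, i.e. converges for all values of $x^{-1}$ in $\mathbf C_\infty$. Let $\mathbf K_L\subset\mathbf C_\infty$ be generated over $\mathbf K$ by all $\langle I\rangle$ and all $c(I)$. For fixed $y$ let $\mathbf K_L(y)$ be generated over $\mathbf K_L$ by the zeroes $\beta\in\mathbf C_\infty^\ast$ of $L(x,y)$ in $x$. Let $y\in\mathbb Z_p$ and let $b=b(y)>0$ be a real number such that, for each $\delta\ge b$, there is at most one reciprocal zero $\lambda=1/\beta$ of $L(x,y)$ (not counting multiplicity) with $|\lambda|=\delta$. Then: 1. every zero $\beta$ of $L(x,y)$ with $1/|\beta|>b(y)$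 is totally inseparable over $\mathbf K_L$; 2. the maximal subextension of $\mathbf K_L(y)/\mathbf K_L$ that is separable over $\mathbf K_L$ is finite over $\mathbf K$. In particular, if such a $b(y)$ exists for every $y\in\mathbb Z_p$, then 2 holds for every $y\in\mathbb Z_p$. **The finite places.** Let $v$ be a nonzero prime ideal of $\mathbf A$, $\mathbf k_v$ the completion of $\mathbf k$ at $v$, $\mathbf C_v$ the completion of an algebraic closure of $\mathbf k_v$, and $\tau\colon\overline{\mathbf k}\to\mathbf C_v$ a $\mathbf k$-embedding, where $\overline{\mathbf k}$ is the algebraic closure of $\mathbf k$ in $\mathbf C_\infty$. Fix $\pi_\ast\in\mathbf C_\infty$ with $\pi_\ast^{d_\infty}=\pi$. Suppose that the $c(I)$ lie in a finite extension of $\mathbf k$ in $\mathbf C_\infty$. For a nonzero ideal $I$ of $\mathbf A$ put $I_1=\pi_\ast^{-\deg I}\langle I\rangle\in\overline{\mathbf k}$. For $I$ prime to $v$ write $\tau(I_1)=\omega_I u_I$ with $\omega_I$ a root of unity and $u_I$ a $1$-unit of $\mathbf C_v$. For an exponent $s_v=(j,y)\in\mathbb Z\times\mathbb Z_p$ (where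 $j$ matters only modulo a common order of the $\omega_I$) put $$L_v(x_v,s_v)=\sum_{I\text{ prime to }v}\tau(c(I))\,x_v^{-\deg I}\,\omega_I^{-j}u_I^{-y},$$ and suppose that for each $s_v$ this is an entire power series in $x_v^{-1}$ over $\mathbf C_v$. Then the same two conclusions hold for $L_v(x_v,s_v)$, for each $s_v$ and each $b=b(s_v)>0$ with the corresponding property: with $\mathbf C_v$ in place of $\mathbf C_\infty$, $\mathbf k_v$ in place of $\mathbf K$, and the extension of $\mathbf k_v$ generated by all $\tau(I_1)$ and all $\tau(c(I))$ ($I$ ranging over the nonzero ideals of $\mathbf A$) in place of $\mathbf K_L$. -/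

import Mathlib

open scoped nonZeroDivisors

noncomputable section

namespace CharPL

/-! ### The base: an affine curve with one point at infinity, and its completions -/

/-- `A` is the affine ring of `X ∖ ∞` for a smooth projective geometrically connected curve `X`
over the finite field `Fr` with function field `k` and a closed point `∞` of `X`, given by its
valuation ring `inf ⊆ k`.  Closed points of `X` are the nontrivial valuation rings of `k`.
So `A` is a finitely generated `Fr`-algebra, it is Dedekind (an instance argument), `Fr` is the
full field of constants of `k`, and `inf` is the only valuation ring of `k`
that does not contain `A`. -/
structure IsAffineRingAway (Fr A k : Type*) [Field Fr] [CommRing A] [Field k] [Algebra Fr A]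
    [Algebra A k] [Algebra Fr k] [IsDedekindDomain A] [IsFractionRing A k]
    (inf : ValuationSubring k) : Prop where
  finiteType : Algebra.FiniteType Fr A
  constants : IsIntegrallyClosedIn Fr k
  contains_iff : ∀ O : ValuationSubring k, (∀ a : A, algebraMap A k a ∈ O) ↔ O ≠ inf

/-- The normed field `K` is the completion of `k` at the place with valuation ring `O`. -/
structure IsCompletionAt {k : Type*} [Field k] (O : ValuationSubring k)
    (K : Type*) [NontriviallyNormedField K] [Algebra k K] : Prop where
  complete : CompleteSpace K
  ultrametric : IsUltrametricDist K
  dense : DenseRange (algebraMap k K)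
  norm_le_one_iff : ∀ x : k, ‖algebraMap k K x‖ ≤ 1 ↔ x ∈ O

/-- The normed field `C` is the completion of an algebraic closure of the valued field `K`,
with the absolute value extending that of `K`. -/
structure IsCompletedAlgClosure (K C : Type*) [NontriviallyNormedField K] [NormedField C]
    [NormedAlgebra K C] : Prop where
  complete : CompleteSpace C
  ultrametric : IsUltrametricDist C
  algClosed : IsAlgClosed C
  dense : Dense {x : C | IsAlgebraic K x}

/-- A sign function `sgn : Kˣ → 𝔽_∞ˣ` (the identity on `𝔽_∞ˣ`, where `𝔽_∞` is the field of
constants of `K`), together with a positive uniformizer `π` of `K`. -/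
structure SignData (Fr K : Type*) [Field Fr] [NontriviallyNormedField K] [Algebra Fr K] where
  sgn : Kˣ →* (algebraicClosure Fr K)ˣ
  sgn_const : ∀ x : (algebraicClosure Fr K)ˣ,
    sgn (Units.map (algebraMap (algebraicClosure Fr K) K : _ →* K) x) = x
  π : Kˣ
  sgn_π : sgn π = 1
  norm_π_lt_one : ‖(π : K)‖ < 1
  norm_le_norm_π : ∀ x : K, ‖x‖ < 1 → ‖x‖ ≤ ‖(π : K)‖

/-! ### Exponentiation of ideals at infinity -/

section Infinity

variable {Fr K : Type*} [Field Fr] [NontriviallyNormedField K] [Algebra Fr K]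
  (S : SignData Fr K)

/-- The normalized valuation `v_∞` of `K`, with `v_∞ (π) = 1`. -/
def SignData.ord (z : Kˣ) : ℤ :=
  Classical.epsilon fun n : ℤ => ‖(z : K)‖ = ‖(S.π : K)‖ ^ n

/-- `⟨z⟩ = π ^ (-v_∞ z) * z`, a `1`-unit when `z` is positive. -/
def SignData.angle (z : Kˣ) : Kˣ := S.π ^ (-S.ord z) * z

/-- The degree `d_∞` of `∞` over `Fr`. -/
def degInf (Fr K : Type*) [Field Fr] [Field K] [Algebra Fr K] : ℕ :=
  Module.finrank Fr (algebraicClosure Fr K)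

/-- The sign of a nonzero element of `k`. -/
def SignData.sgnOn (k : Type*) [Field k] [Algebra k K] : kˣ →* (algebraicClosure Fr K)ˣ :=
  S.sgn.comp (Units.map (algebraMap k K : k →* K))

/-- The group `𝒫₊` of principal and positively generated fractional ideals. -/
def SignData.posPrincipal (A k : Type*) [CommRing A] [Field k] [Algebra A k] [IsFractionRing A k]
    [Algebra k K] : Subgroup (FractionalIdeal A⁰ k)ˣ :=
  (S.sgnOn k).ker.map (toPrincipalIdeal A k)

/-- `⟨I⟩`, for a fractional ideal `I`: with `e` the index of `𝒫₊` in the group of fractional ideals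
and `I ^ e = (i)`, `i` positive, it is the unique `1`-unit of `C` whose `e`-th power is `⟨i⟩`. -/
def SignData.bracket {A k : Type*} [CommRing A] [Field k] [Algebra A k] [IsFractionRing A k]
    [Algebra k K] (C : Type*) [NormedField C] [NormedAlgebra K C]
    (I : (FractionalIdeal A⁰ k)ˣ) : C :=
  Classical.epsilon fun u : C => ‖u - 1‖ < 1 ∧ ∃ i : kˣ, S.sgnOn k i = 1 ∧
    toPrincipalIdeal A k i = I ^ (S.posPrincipal A k).index ∧
    u ^ (S.posPrincipal A k).index =
      algebraMap K C (S.angle (Units.map (algebraMap k K : k →* K) i) : Kˣ)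

end Infinity

/-- `u ^ y` for a `1`-unit `u` and `y ∈ ℤ_p`: the limit of `u ^ n` along the natural numbers
`n = y mod p ^ m`, which tend `p`-adically to `y`. -/
def padicPow {p : ℕ} [Fact p.Prime] {C : Type*} [NormedField C] (u : C) (y : ℤ_[p]) : C :=
  Filter.atTop.limUnder fun m : ℕ => u ^ (y.appr m)

/-- The degree of a nonzero ideal `I` of `A`, that is `dim_{Fr} (A / I)`. -/
def ideg (Fr : Type*) {A : Type*} [Field Fr] [CommRing A] [Algebra Fr A] (I : (Ideal A)⁰) : ℕ :=
  Module.finrank Fr (A ⧸ (I : Ideal A))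

/-! ### Dirichlet series at infinity -/

section Series

variable {Fr A K C : Type*} (k : Type*) [Field Fr] [CommRing A] [IsDedekindDomain A] [Field k]
  [Algebra Fr A] [Algebra A k] [IsFractionRing A k]
  [NontriviallyNormedField K] [Algebra Fr K] [Algebra k K]
  [NormedField C] [NormedAlgebra K C]

/-- The coefficient of `x⁻ᵈ` in `L(x, y) = ∑_I c(I) x^(-deg I) ⟨I⟩^(-y)`; the sum is over the
(finitely many) nonzero ideals of degree `d`. -/
def coeffInf {p : ℕ} [Fact p.Prime] (S : SignData Fr K) (c : (Ideal A)⁰ → C)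
    (y : ℤ_[p]) (d : ℕ) : C :=
  ∑ᶠ I ∈ {I : (Ideal A)⁰ | ideg Fr I = d},
    c I * padicPow (S.bracket C (FractionalIdeal.mk0 k I)) (-y)

/-- The field `𝐊_L`: the local value field `𝐊_𝐕 = 𝐊(⟨I⟩ : I)` with the coefficients `c(I)`
of the Dirichlet series adjoined. -/
def fieldInf (S : SignData Fr K) (c : (Ideal A)⁰ → C) : IntermediateField K C :=
  IntermediateField.adjoin K
    (Set.range (fun I : (FractionalIdeal A⁰ k)ˣ => S.bracket C I) ∪ Set.range c)

/-! ### The interpolation at a finite place -/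

/-- The element `I^(-(π_*, -1)) = π_*^(-deg I) ⟨I⟩` of `C`.  It is algebraic over `k`,
and it is `a` if `I = (a)` with `a` positive. -/
def idealValue (S : SignData Fr K) (πs : C) (I : (Ideal A)⁰) : C :=
  πs⁻¹ ^ ideg Fr I * S.bracket C (FractionalIdeal.mk0 k I)

variable {Cv : Type*} [NormedField Cv] [Algebra k Cv] [Algebra k C]

/-- Transport of an element of `C` that is algebraic over `k` to `Cv`, along a `k`-embedding `τ`
of the algebraic closure of `k` in `C` (the value on other elements is irrelevant). -/
def transport {k : Type*} [Field k] [Algebra k C] [Algebra k Cv]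
    (τ : algebraicClosure k C →ₐ[k] Cv) (z : C) : Cv :=
  open Classical in if h : z ∈ algebraicClosure k C then τ ⟨z, h⟩ else 0

/-- The root of unity congruent to the unit `w` (the Teichmüller representative of `w`). -/
def teich (w : Cv) : Cv :=
  Classical.epsilon fun ω : Cv => (∃ n : ℕ, 0 < n ∧ ω ^ n = 1) ∧ ‖w - ω‖ < 1

/-- `w ^ (j, y) = ω ^ j * (w / ω) ^ y` for a unit `w` with Teichmüller representative `ω`. -/
def unitPow {p : ℕ} [Fact p.Prime] (w : Cv) (j : ℤ) (y : ℤ_[p]) : Cv :=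
  teich w ^ j * padicPow (w / teich w) y

/-- The coefficient of `x_v⁻ᵈ` in
`L_v(x_v, s_v) = ∑_I c(I) x_v^(-deg I) I^(-s_v)`, `s_v = (j, y)`; the sum is over the ideals `I`
of degree `d` prime to `v`. -/
def coeffFin {p : ℕ} [Fact p.Prime] (S : SignData Fr K) (πs : C)
    (v : IsDedekindDomain.HeightOneSpectrum A) (τ : algebraicClosure k C →ₐ[k] Cv)
    (c : (Ideal A)⁰ → C) (j : ℤ) (y : ℤ_[p]) (d : ℕ) : Cv :=
  ∑ᶠ I ∈ {I : (Ideal A)⁰ | ideg Fr I = d ∧ ¬ (I : Ideal A) ≤ v.asIdeal},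
    transport τ (c I) * unitPow (transport τ (idealValue k S πs I)) (-j) (-y)

/-- The `v`-adic analogue of `𝐊_L`: the `v`-adic local value field, generated over `k_v` by the
elements `I^(-(π_*, -1))`, with the coefficients `c(I)` adjoined. -/
def fieldFin (Kv : Type*) [NontriviallyNormedField Kv] [NormedAlgebra Kv Cv]
    (S : SignData Fr K) (πs : C) (τ : algebraicClosure k C →ₐ[k] Cv)
    (c : (Ideal A)⁰ → C) : IntermediateField Kv Cv :=
  IntermediateField.adjoin Kv
    (Set.range (fun I : (Ideal A)⁰ => transport τ (idealValue k S πs I)) ∪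
      Set.range (fun I : (Ideal A)⁰ => transport τ (c I)))

end Series

/-! ### Zeroes of power series in `x⁻¹` -/

section Zeroes

variable {C : Type*} [NormedField C]

/-- The power series `∑ a_d x⁻ᵈ` converges for all values of `x⁻¹`. -/
def IsEntire (a : ℕ → C) : Prop := ∀ u : C, Summable fun d => a d * u ^ d

/-- `β` is a (nonzero) zero, in the variable `x`, of `∑ a_d x⁻ᵈ`. -/
def IsZeroOf (a : ℕ → C) (β : C) : Prop := β ≠ 0 ∧ HasSum (fun d => a d * β⁻¹ ^ d) 0

/-- The positive number `b` is such that for each `δ ≥ b` there is at most one reciprocal zero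
(taken without multiplicity) of absolute value `δ`. -/
def IsGRHBound (a : ℕ → C) (b : ℝ) : Prop :=
  0 < b ∧ ∀ δ : ℝ, b ≤ δ → {l : C | IsZeroOf a l⁻¹ ∧ ‖l‖ = δ}.Subsingleton

/-- The field obtained from `E` by adjoining all the zeroes of `∑ a_d x⁻ᵈ`. -/
def zeroField {F : Type*} [Field F] [Algebra F C] (E : IntermediateField F C) (a : ℕ → C) :
    IntermediateField E C :=
  IntermediateField.adjoin E {β : C | IsZeroOf a β}

/-- The maximal subextension of `E(zeroes)/E` that is separable over `E` is finite over `F`. -/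
def FiniteSeparablePart {F : Type*} [Field F] [Algebra F C] (E : IntermediateField F C)
    (a : ℕ → C) : Prop :=
  FiniteDimensional F (separableClosure E (zeroField E a))

/-- `β` is totally inseparable over `E`. -/
def TotallyInseparable {F : Type*} [Field F] [Algebra F C] (E : IntermediateField F C)
    (β : C) : Prop :=
  IsPurelyInseparable E (IntermediateField.adjoin E {β})

end Zeroes

end CharPL

end

/-!
The coefficients of `L(x, y)`, and those of `L_v(x_v, s_v)`, lie in a field `E` that is finite over
a complete field: over `K` at infinity, over `k_v` at a finite place. Everything about the zeroes
follows from this alone.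

*Zeroes of entire series over `E`.* A nonzero zero `u` of an entire series with coefficients in `E`
is algebraic over `E` (`isAlgebraic_of_hasSum_zero`), and a conjugate of a zero is again a zero, of
the same absolute value, because embeddings of a finite extension of a complete field are continuous
(`isZeroOf_of_conj`). If there is only one zero of that absolute value, it has no other conjugate,
so it is totally inseparable. By Strassmann's theorem (`IsEntire.finite_zeros`) only finitely many
reciprocal zeroes have absolute value at most `b`. The field generated by all zeroes is therefore
purely inseparable over the finite extension generated by these, and so its separable part is
contained in that finite extension (`finiteDimensional_separableClosure_adjoin`). The result
is `totallyInseparable_and_finiteSeparablePart`.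

*Finiteness of `E`.* Since every valuation ring of `k` but the one at infinity contains `A`, the
ring `A` is finite over `Fr[t]` for each `t ∈ A` with a pole at infinity
(`IsAffineRingAway.finite_polyAlgebra`). Hence the class group is finite, the residues at infinity
are represented by a finite field of constants, and the sign of an element of absolute value `1` is
its residue; so the index `e` of the positively generated principal ideals is nonzero
(`index_posPrincipal_ne_zero`) and the one-units `⟨I⟩` exist.
If `I = J (a)` with `a` positive, then `⟨I⟩ = ⟨a⟩ ⟨J⟩` (`bracket_mul`),
because one-units have no torsion in characteristic `p` and a positive generator of an ideal is
unique. Finitely many `⟨J⟩` thus generate all `⟨I⟩` over `K`.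

*Finite places.* The product formula `dim A / (a) = -d_∞ v_∞(a)` (`finrank_quotient_span`) shows
that the `e`-th power of `I_1 = π_* ^ (-deg I) ⟨I⟩` is the positive generator of `I ^ e`
(`idealValue_pow`), an element of `k`. So `I_1` is algebraic over `k`, the `τ(I_1)` generate a
finite extension of `k_v`, and for `I` prime to `v` some power of `τ(I_1)` is a one-unit, which
provides the Teichmüller representative. This representative and `p`-adic powers of one-units are
limits of powers, and so stay in the complete field `E`.
-/

noncomputable section

namespace CharPL

open Filter Topology Polynomial

set_option linter.unusedSectionVars false

/-! ### Entire power series over a complete ultrametric field -/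

section Sequences

/-- A nonnegative null sequence attains its maximum. -/
theorem exists_forall_le_of_tendsto_zero {s : ℕ → ℝ} (h0 : ∀ d, 0 ≤ s d)
    (hs : Tendsto s atTop (𝓝 0)) : ∃ m, ∀ d, s d ≤ s m := by
  by_cases hz : ∃ m, 0 < s m
  · obtain ⟨m, hm⟩ := hz
    have hfin : {d | s m ≤ s d}.Finite := by
      have h1 : ∀ᶠ d in cofinite, s d < s m := by
        rw [Nat.cofinite_eq_atTop]; exact hs.eventually_lt_const hm
      simpa [Filter.eventually_cofinite] using h1
    obtain ⟨n, hn, hmax⟩ := Set.exists_max_image _ s hfin ⟨m, le_refl (s m)⟩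
    refine ⟨n, fun d => ?_⟩
    rcases le_or_gt (s m) (s d) with h | h
    · exact hmax d h
    · exact h.le.trans hn
  · push Not at hz
    exact ⟨0, fun d => (hz d).trans (h0 0)⟩

/-- The last index at which a nonzero null sequence is maximal; the later terms are smaller by a
uniform factor `θ < 1`. -/
theorem exists_last_max {s : ℕ → ℝ} (h0 : ∀ d, 0 ≤ s d) (hs : Tendsto s atTop (𝓝 0))
    (hne : ∃ d, s d ≠ 0) :
    ∃ (N : ℕ) (θ : ℝ), 0 < s N ∧ 0 < θ ∧ θ < 1 ∧ (∀ d, s d ≤ s N) ∧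
      ∀ d, N < d → s d ≤ θ * s N := by
  obtain ⟨m, hm⟩ := exists_forall_le_of_tendsto_zero h0 hs
  obtain ⟨d0, hd0⟩ := hne
  have hpos : 0 < s m := ((h0 d0).lt_of_ne' hd0).trans_le (hm d0)
  have hfin : {d | s d = s m}.Finite := by
    have h1 : ∀ᶠ d in cofinite, s d < s m := by
      rw [Nat.cofinite_eq_atTop]; exact hs.eventually_lt_const hpos
    exact (Filter.eventually_cofinite.mp h1).subset fun d hd => by
      simp only [Set.mem_ofPred_eq] at hd ⊢; rw [hd]; exact lt_irrefl _
  obtain ⟨N, hN, hlast⟩ := Set.exists_max_image _ id hfin ⟨m, rfl⟩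
  simp only [Set.mem_ofPred_eq, id] at hN hlast
  obtain ⟨k, hk⟩ := exists_forall_le_of_tendsto_zero (s := fun d => s (d + (N + 1)))
    (fun d => h0 _) ((tendsto_add_atTop_iff_nat (N + 1)).mpr hs)
  have hlt : s (k + (N + 1)) < s N := by
    refine lt_of_le_of_ne (hN ▸ hm _) fun h => ?_
    have := hlast _ (h.trans hN)
    omega
  have hNpos : 0 < s N := hN ▸ hpos
  refine ⟨N, max (1 / 2) (s (k + (N + 1)) / s N), hNpos, lt_max_of_lt_left (by norm_num),
    max_lt (by norm_num) ((div_lt_one hNpos).mpr hlt), fun d => hN ▸ hm d, fun d hd => ?_⟩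
  have h1 : s d ≤ s (k + (N + 1)) := by
    have := hk (d - (N + 1))
    simpa [Nat.sub_add_cancel (show N + 1 ≤ d from hd)] using this
  calc s d ≤ s (k + (N + 1)) / s N * s N := by rwa [div_mul_cancel₀ _ hNpos.ne']
    _ ≤ _ := by gcongr; exact le_max_right _ _

end Sequences

section Strassmann

variable {C : Type*} [NormedField C] [IsUltrametricDist C]

theorem norm_le_of_hasSum {f : ℕ → C} {x : C} {B : ℝ} (hf : HasSum f x) (hB : ∀ i, ‖f i‖ ≤ B) :
    ‖x‖ ≤ B := by
  refine le_of_tendsto hf.norm (Eventually.of_forall fun t => ?_)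
  exact IsUltrametricDist.norm_sum_le_of_forall_le_of_nonneg ((norm_nonneg _).trans (hB 0))
    fun i _ => hB i

theorem summable_of_norm_tendsto_zero [CompleteSpace C] {f : ℕ → C}
    (h : Tendsto (fun i => ‖f i‖) atTop (𝓝 0)) : Summable f := by
  apply NonarchimedeanAddGroup.summable_of_tendsto_cofinite_zero
  rw [Nat.cofinite_eq_atTop]
  exact tendsto_zero_iff_norm_tendsto_zero.mpr h

/-- Strassmann's theorem: if the `N`-th term of `∑ a_d x^d` dominates all later ones on the disc of
radius `r`, the series has only finitely many zeros there.  Dividing by `X - u`, for a zero `u`,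
lowers `N` by one. -/
theorem finite_zeros_of_dominant [CompleteSpace C] {r : ℝ} (hr : 0 < r) (N : ℕ) :
    ∀ (a : ℕ → C), Tendsto (fun d => ‖a d‖ * r ^ d) atTop (𝓝 0) → a N ≠ 0 →
      ∀ θ : ℝ, 0 < θ → θ < 1 → (∀ d, N < d → ‖a d‖ * r ^ d ≤ θ * (‖a N‖ * r ^ N)) →
      {u : C | ‖u‖ ≤ r ∧ HasSum (fun d => a d * u ^ d) 0}.Finite := by
  induction N with
  | zero =>
    intro a _ ha θ hθ hθ1 hdom
    convert Set.finite_empty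
    ext u
    simp only [Set.mem_ofPred_eq, Set.mem_empty_iff_false, iff_false, not_and]
    intro hu hsum
    have h1 := (hasSum_nat_add_iff' 1).mpr hsum
    have h2 : ‖(0 : C) - ∑ i ∈ Finset.range 1, a i * u ^ i‖ ≤ θ * ‖a 0‖ := by
      refine norm_le_of_hasSum h1 fun i => ?_
      rw [norm_mul, norm_pow]
      calc ‖a (i + 1)‖ * ‖u‖ ^ (i + 1) ≤ ‖a (i + 1)‖ * r ^ (i + 1) := by gcongr
        _ ≤ _ := by simpa using hdom (i + 1) (by omega)
    simp only [Finset.range_one, Finset.sum_singleton, pow_zero, mul_one, zero_sub, norm_neg] at h2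
    nlinarith [norm_pos_iff.mpr ha]
  | succ N ih =>
    intro a hlim ha θ hθ hθ1 hdom
    by_cases hne : ∃ u : C, ‖u‖ ≤ r ∧ HasSum (fun d => a d * u ^ d) 0
    swap
    · convert Set.finite_empty
      ext u
      simpa using fun h1 h2 => hne ⟨u, h1, h2⟩
    obtain ⟨u, hur, hu⟩ := hne
    -- the coefficients of the quotient by `X - u`
    have hterm : ∀ m j, ‖a (m + 1 + j) * u ^ j‖ * r ^ (m + 1) ≤
        ‖a (m + 1 + j)‖ * r ^ (m + 1 + j) := fun m j => by
      rw [norm_mul, norm_pow, pow_add _ (m + 1), mul_assoc, mul_comm (‖u‖ ^ j)]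
      gcongr
    have hsumm : ∀ m, Summable fun j => a (m + 1 + j) * u ^ j := fun m => by
      apply summable_of_norm_tendsto_zero
      have h2 := hlim.comp (tendsto_add_atTop_nat (m + 1))
      have h3 := h2.mul_const ((r ^ (m + 1))⁻¹)
      rw [zero_mul] at h3
      refine squeeze_zero (fun _ => norm_nonneg _) (fun j => ?_) h3
      rw [← div_eq_mul_inv, le_div_iff₀ (by positivity)]
      simpa [add_comm, add_left_comm] using hterm m j
    set q : ℕ → C := fun m => ∑' j, a (m + 1 + j) * u ^ j with hq
    have hqsum : ∀ m, HasSum (fun j => a (m + 1 + j) * u ^ j) (q m) := fun m => (hsumm m).hasSum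
    have hrec : ∀ m, a (m + 1) = q m - u * q (m + 1) := fun m => by
      have h1 := (hasSum_nat_add_iff' 1).mpr (hqsum m)
      have h2 := (hqsum (m + 1)).mul_left u
      have h3 : (fun j => a (m + 1 + (j + 1)) * u ^ (j + 1)) =
          fun j => u * (a (m + 1 + 1 + j) * u ^ j) := by
        ext j
        rw [show m + 1 + (j + 1) = m + 1 + 1 + j by ring]; ring
      rw [h3] at h1
      have h4 := h1.unique h2
      simp at h4
      rw [← h4]; ring
    have hrec0 : a 0 = -(u * q 0) := by
      have h1 := (hasSum_nat_add_iff' 1).mpr hu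
      have h2 := (hqsum 0).mul_left u
      have h3 : (fun j => a (j + 1) * u ^ (j + 1)) = fun j => u * (a (0 + 1 + j) * u ^ j) := by
        ext j
        rw [show 0 + 1 + j = j + 1 by ring]; ring
      rw [h3] at h1
      have h4 := h1.unique h2
      simp at h4
      rw [← h4]; ring
    have hqbound : ∀ m B, (∀ d, m < d → ‖a d‖ * r ^ d ≤ B) → ‖q m‖ * r ^ (m + 1) ≤ B :=
      fun m B hB => by
        rw [← le_div_iff₀ (by positivity)]
        refine norm_le_of_hasSum (hqsum m) fun j => ?_
        rw [le_div_iff₀ (by positivity)]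
        exact (hterm m j).trans (hB _ (by omega))
    have hqlim' : Tendsto (fun m => ‖q m‖ * r ^ (m + 1)) atTop (𝓝 0) := by
      rw [Metric.tendsto_atTop] at hlim ⊢
      intro ε hε
      obtain ⟨M, hM⟩ := hlim (ε / 2) (by positivity)
      refine ⟨M, fun m hm => ?_⟩
      rw [Real.dist_eq, sub_zero, abs_of_nonneg (by positivity)]
      refine (hqbound m (ε / 2) fun d hd => ?_).trans_lt (by linarith)
      have := hM d (by omega)
      rw [Real.dist_eq, sub_zero, abs_of_nonneg (by positivity)] at this
      exact this.le
    have hqlim : Tendsto (fun m => ‖q m‖ * r ^ m) atTop (𝓝 0) := by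
      have := hqlim'.mul_const r⁻¹
      rw [zero_mul] at this
      refine this.congr fun m => ?_
      field_simp
      ring
    -- the dominant coefficient of the quotient has the same absolute value
    have hqN : ‖q N‖ = ‖a (N + 1)‖ := by
      have h1 : ‖u * q (N + 1)‖ < ‖a (N + 1)‖ := by
        have h2 := hqbound (N + 1) (θ * (‖a (N + 1)‖ * r ^ (N + 1))) hdom
        rw [norm_mul]
        have h3 : ‖u‖ * ‖q (N + 1)‖ * r ^ (N + 1) ≤ ‖q (N + 1)‖ * r ^ (N + 1 + 1) := by
          rw [pow_succ _ (N + 1)]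
          nlinarith [mul_le_mul_of_nonneg_right hur
            (show 0 ≤ ‖q (N + 1)‖ * r ^ (N + 1) by positivity)]
        have h4 : 0 < ‖a (N + 1)‖ * r ^ (N + 1) := by
          have := norm_pos_iff.mpr ha
          positivity
        have h5 : ‖u‖ * ‖q (N + 1)‖ * r ^ (N + 1) < ‖a (N + 1)‖ * r ^ (N + 1) := by nlinarith
        exact lt_of_mul_lt_mul_right h5 (by positivity)
      have h2 : q N = a (N + 1) + u * q (N + 1) := by rw [hrec N]; ring
      rw [h2, IsUltrametricDist.norm_add_eq_max_of_norm_ne_norm h1.ne']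
      exact max_eq_left h1.le
    have hqN0 : q N ≠ 0 := by rw [← norm_pos_iff, hqN]; exact norm_pos_iff.mpr ha
    have hfin := ih q hqlim hqN0 θ hθ hθ1 fun d hd => by
      have h1 := hqbound d (θ * (‖a (N + 1)‖ * r ^ (N + 1))) fun e he => hdom e (by omega)
      rw [hqN]
      rw [pow_succ, ← mul_assoc, pow_succ, ← mul_assoc, ← mul_assoc] at h1
      rw [← mul_assoc]
      exact le_of_mul_le_mul_right h1 hr
    refine (hfin.union (Set.finite_singleton u)).subset fun w hw => ?_
    by_cases hwu : w = u
    · exact Or.inr hwu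
    left
    refine ⟨hw.1, ?_⟩
    have hs : Summable fun d => q d * w ^ d := by
      apply summable_of_norm_tendsto_zero
      refine squeeze_zero (fun _ => norm_nonneg _) (fun j => ?_) hqlim
      rw [norm_mul, norm_pow]
      gcongr
      exact hw.1
    -- multiplying the partial sums of the quotient by `w - u` telescopes
    have htel : ∀ M, ∑ d ∈ Finset.range (M + 1), a d * w ^ d =
        (w - u) * ∑ d ∈ Finset.range M, q d * w ^ d - u * (q M * w ^ M) := fun M => by
      induction M with
      | zero => simp [hrec0]
      | succ M ihM =>
        rw [Finset.sum_range_succ, ihM, hrec M, Finset.sum_range_succ]; ring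
    have h1 := (tendsto_add_atTop_iff_nat 1).mpr hw.2.tendsto_sum_nat
    have h2 := ((hs.hasSum.tendsto_sum_nat).const_mul (w - u)).sub
      ((hs.tendsto_atTop_zero).const_mul u)
    have h3 := tendsto_nhds_unique h1 (h2.congr fun M => (htel M).symm)
    rw [mul_zero, sub_zero, eq_comm, mul_eq_zero] at h3
    have h4 := h3.resolve_left (sub_ne_zero.mpr hwu)
    rw [← h4]
    exact hs.hasSum

/-- A nonzero entire series has finitely many zeros in each disc. -/
theorem IsEntire.finite_zeros [CompleteSpace C] {a : ℕ → C} (ha : IsEntire a)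
    (hne : ∃ d, a d ≠ 0) {t : C} (ht : t ≠ 0) :
    {u : C | ‖u‖ ≤ ‖t‖ ∧ HasSum (fun d => a d * u ^ d) 0}.Finite := by
  have htpos := norm_pos_iff.mpr ht
  have hlim : Tendsto (fun d => ‖a d‖ * ‖t‖ ^ d) atTop (𝓝 0) := by
    simpa using (ha t).tendsto_atTop_zero.norm
  obtain ⟨d0, hd0⟩ := hne
  obtain ⟨N, θ, hN, hθ, hθ1, -, hdom⟩ := exists_last_max (fun d => by positivity) hlim
    ⟨d0, mul_ne_zero (norm_ne_zero_iff.mpr hd0) (by positivity)⟩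
  exact finite_zeros_of_dominant htpos N a hlim
    (fun h => by simp [h] at hN) θ hθ hθ1 hdom

end Strassmann

/-! ### Zeros: algebraicity, conjugates and inseparability -/

/-- If all elements of `Z` outside a finite set of algebraic elements are purely inseparable over
`E`, the separable part of `E(Z) / E` is finite: it lies in the field `E₀` generated by the finite
set, since `E(Z)` is purely inseparable over `E₀`. -/
theorem finiteDimensional_separableClosure_adjoin (E : Type*) {C : Type*} [Field E] [Field C]
    [Algebra E C] {Z Z₀ : Set C} (hfin : Z₀.Finite) (halg : ∀ β ∈ Z₀, IsIntegral E β)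
    (hins : ∀ β ∈ Z, β ∉ Z₀ → IsPurelyInseparable E (IntermediateField.adjoin E {β})) :
    FiniteDimensional E (separableClosure E (IntermediateField.adjoin E Z)) := by
  set M := IntermediateField.adjoin E Z
  set E₀ := IntermediateField.adjoin E Z₀
  have : Finite Z₀ := hfin
  have hE₀ : FiniteDimensional E E₀ := IntermediateField.finiteDimensional_adjoin halg
  have hM : M ≤ (perfectClosure E₀ C).restrictScalars E := by
    rw [IntermediateField.adjoin_le_iff]
    intro β hβ
    change β ∈ perfectClosure E₀ C
    obtain ⟨q, hq⟩ := ExpChar.exists E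
    have hq₀ : ExpChar E₀ q := expChar_of_injective_algebraMap (algebraMap E E₀).injective q
    rw [mem_perfectClosure_iff_pow_mem q]
    by_cases h0 : β ∈ Z₀
    · exact ⟨0, ⟨⟨β, IntermediateField.subset_adjoin _ _ h0⟩, by rw [pow_zero, pow_one]; rfl⟩⟩
    · have h1 := hins β hβ h0
      rw [IntermediateField.isPurelyInseparable_adjoin_simple_iff_pow_mem E C q] at h1
      obtain ⟨n, x, hx⟩ := h1
      exact ⟨n, algebraMap E E₀ x, hx⟩
  have hsep : ∀ x : separableClosure E M, ((x : M) : C) ∈ E₀ := by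
    intro x
    have h1 : IsSeparable E ((x : M) : C) := by
      have := mem_separableClosure_iff.mp x.2
      rw [IsSeparable] at this ⊢
      rwa [← minpoly.algebraMap_eq (algebraMap M C).injective] at this
    have h2 : IsSeparable E₀ ((x : M) : C) := h1.tower_top E₀
    have h3 : ((x : M) : C) ∈ perfectClosure E₀ C := hM (x : M).2
    have h4 : ((x : M) : C) ∈ separableClosure E₀ C := mem_separableClosure_iff.mpr h2
    have h5 := (separableClosure_inf_perfectClosure E₀ C).le ⟨h4, h3⟩
    obtain ⟨y, hy⟩ := IntermediateField.mem_bot.mp h5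
    exact hy ▸ y.2
  let f : separableClosure E M →ₗ[E] E₀ :=
    { toFun := fun x => ⟨((x : M) : C), hsep x⟩
      map_add' := fun _ _ => rfl
      map_smul' := fun _ _ => rfl }
  refine FiniteDimensional.of_injective f fun x y hxy => ?_
  have h := congrArg (Subtype.val) hxy
  exact Subtype.ext (Subtype.ext h)

section Algebraicity

variable {K C : Type*} [NontriviallyNormedField K] [CompleteSpace K] [NormedField C]
  [NormedAlgebra K C]

/-- A finite-dimensional subspace over an intermediate field that is finite over the complete base
is closed. -/
theorem isClosed_of_finite (E : IntermediateField K C) [FiniteDimensional K E]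
    (V : Submodule E C) [Module.Finite E V] : IsClosed (V : Set C) := by
  have h : Module.Finite K (V.restrictScalars K) := Module.Finite.trans (R := K) E V
  exact (V.restrictScalars K).closed_of_finiteDimensional

theorem isClosed_intermediateField (E : IntermediateField K C) [FiniteDimensional K E] :
    IsClosed (E : Set C) := by
  have h : Module.Finite K (Subalgebra.toSubmodule E.toSubalgebra) :=
    inferInstanceAs (Module.Finite K E)
  exact (Subalgebra.toSubmodule E.toSubalgebra).closed_of_finiteDimensional

/-- A nonzero zero of a nonzero convergent power series over a field `E`, finite over the complete
field `K`, is algebraic over `E`.  If `N` is the last index where the terms are maximal, the series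
expresses `u ^ N` by lower powers and strictly smaller contributions of higher powers, so that the
relative distance of every power of `u` to the span of `1, …, u ^ (N - 1)` shrinks
by a factor `θ < 1`, and hence vanishes. -/
theorem isAlgebraic_of_hasSum_zero [IsUltrametricDist C] (E : IntermediateField K C)
    [FiniteDimensional K E] {a : ℕ → C}
    (haE : ∀ d, a d ∈ E) (hne : ∃ d, a d ≠ 0) {u : C} (hu0 : u ≠ 0)
    (hu : HasSum (fun d => a d * u ^ d) 0) : IsAlgebraic E u := by
  have hupos := norm_pos_iff.mpr hu0
  have hlim : Tendsto (fun d => ‖a d‖ * ‖u‖ ^ d) atTop (𝓝 0) := by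
    simpa using hu.summable.tendsto_atTop_zero.norm
  obtain ⟨d0, hd0⟩ := hne
  obtain ⟨N, θ, hN, hθ, hθ1, hmax, hdom⟩ := exists_last_max (fun d => by positivity) hlim
    ⟨d0, mul_ne_zero (norm_ne_zero_iff.mpr hd0) (by positivity)⟩
  have haN : a N ≠ 0 := fun h => by simp [h] at hN
  have haNpos := norm_pos_iff.mpr haN
  set V : Submodule E C := (Polynomial.degreeLT E N).map (Polynomial.aeval u).toLinearMap with hV
  have hVfin : Module.Finite E V := by
    have : Module.Finite E (Polynomial.degreeLT E N) :=
      Module.Finite.equiv (Polynomial.degreeLTEquiv E N).symm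
    infer_instance
  have hpow : ∀ n, n < N → u ^ n ∈ V := fun n hn =>
    ⟨Polynomial.X ^ n, Polynomial.mem_degreeLT.mpr (by
      rw [Polynomial.degree_X_pow]; exact_mod_cast hn), by simp⟩
  -- `D ε x`: the distance from `x` to `V` is at most `ε`
  let D : ℝ → C → Prop := fun ε x => ∃ v ∈ V, ‖x - v‖ ≤ ε
  have hDmul : ∀ {e x : C} {ε ε' : ℝ}, e ∈ E → D ε x → ‖e‖ * ε ≤ ε' → D ε' (e * x) := by
    rintro e x ε ε' he ⟨v, hv, hx⟩ hle
    refine ⟨e * v, V.smul_mem (⟨e, he⟩ : E) hv, ?_⟩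
    rw [← mul_sub, norm_mul]
    exact (mul_le_mul_of_nonneg_left hx (norm_nonneg _)).trans hle
  have hDsum : ∀ {f : ℕ → C} {x : C} {ε : ℝ}, 0 < ε → HasSum f x → (∀ i, D ε (f i)) → D ε x := by
    intro f x ε hε hf hD
    choose v hv hfv using hD
    obtain ⟨t, ht⟩ := (Metric.tendsto_atTop.mp hf ε hε)
    have ht := ht t le_rfl
    refine ⟨∑ i ∈ t, v i, V.sum_mem fun i _ => hv i, ?_⟩
    rw [dist_comm, dist_eq_norm] at ht
    have h1 : x - ∑ i ∈ t, v i = (x - ∑ i ∈ t, f i) + ∑ i ∈ t, (f i - v i) := by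
      rw [Finset.sum_sub_distrib]; ring
    rw [h1]
    exact (IsUltrametricDist.norm_add_le_max _ _).trans (max_le ht.le
      (IsUltrametricDist.norm_sum_le_of_forall_le_of_nonneg hε.le fun i _ => hfv i))
  have key : ∀ j n : ℕ, D (θ ^ j * ‖u‖ ^ n) (u ^ n) := by
    intro j
    induction j with
    | zero => exact fun n => ⟨0, V.zero_mem, by simp⟩
    | succ j ihj =>
      intro n
      induction n using Nat.strong_induction_on with
      | _ n ihn =>
        by_cases hn : n < N
        · exact ⟨u ^ n, hpow n hn, by rw [sub_self, norm_zero]; positivity⟩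
        obtain ⟨m, rfl⟩ := Nat.exists_eq_add_of_le (not_lt.mp hn)
        have h1 := (hasSum_ite_sub_hasSum hu N).mul_right (-((a N)⁻¹ * u ^ m))
        have h2 : (0 - a N * u ^ N) * -((a N)⁻¹ * u ^ m) = u ^ (N + m) := by
          rw [pow_add]; field_simp; ring
        rw [h2] at h1
        refine hDsum (by positivity) h1 fun d => ?_
        split_ifs with hd
        · exact ⟨0, V.zero_mem, by rw [zero_mul, sub_zero, norm_zero]; positivity⟩
        have h3 : a d * u ^ d * -((a N)⁻¹ * u ^ m) = -(a d * (a N)⁻¹) * u ^ (d + m) := by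
          rw [pow_add]; ring
        rw [h3]
        have hmem : -(a d * (a N)⁻¹) ∈ E := E.neg_mem (E.mul_mem (haE d) (E.inv_mem (haE N)))
        rcases lt_or_gt_of_ne hd with hlt | hgt
        · refine hDmul hmem (ihn (d + m) (by omega)) ?_
          rw [norm_neg, norm_mul, norm_inv, pow_add ‖u‖ d, pow_add ‖u‖ N]
          have := hmax d
          calc ‖a d‖ * ‖a N‖⁻¹ * (θ ^ (j + 1) * (‖u‖ ^ d * ‖u‖ ^ m))
              = (‖a d‖ * ‖u‖ ^ d) * (‖a N‖⁻¹ * (θ ^ (j + 1) * ‖u‖ ^ m)) := by ring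
            _ ≤ (‖a N‖ * ‖u‖ ^ N) * (‖a N‖⁻¹ * (θ ^ (j + 1) * ‖u‖ ^ m)) := by gcongr
            _ = _ := by field_simp
        · refine hDmul hmem (ihj (d + m)) ?_
          rw [norm_neg, norm_mul, norm_inv, pow_add ‖u‖ d, pow_add ‖u‖ N]
          have := hdom d hgt
          calc ‖a d‖ * ‖a N‖⁻¹ * (θ ^ j * (‖u‖ ^ d * ‖u‖ ^ m))
              = (‖a d‖ * ‖u‖ ^ d) * (‖a N‖⁻¹ * (θ ^ j * ‖u‖ ^ m)) := by ring
            _ ≤ (θ * (‖a N‖ * ‖u‖ ^ N)) * (‖a N‖⁻¹ * (θ ^ j * ‖u‖ ^ m)) := by gcongr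
            _ = _ := by field_simp; ring
  have hmem : u ^ N ∈ (V : Set C) := by
    rw [← (isClosed_of_finite E V).closure_eq, Metric.mem_closure_iff]
    intro ε hε
    have h1 : Tendsto (fun j : ℕ => θ ^ j * ‖u‖ ^ N) atTop (𝓝 0) := by
      simpa using (tendsto_pow_atTop_nhds_zero_of_lt_one hθ.le hθ1).mul_const (‖u‖ ^ N)
    obtain ⟨j, hj⟩ := (h1.eventually_lt_const hε).exists
    obtain ⟨v, hv, hle⟩ := key j N
    exact ⟨v, hv, by rw [dist_eq_norm]; exact hle.trans_lt hj⟩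
  obtain ⟨q, hq, hqu⟩ := hmem
  refine ⟨Polynomial.X ^ N - q, ?_, ?_⟩
  · rw [sub_eq_add_neg]
    refine (Polynomial.monic_X_pow_add ?_).ne_zero
    rw [Polynomial.degree_neg]
    exact Polynomial.mem_degreeLT.mp hq
  · simpa [sub_eq_zero] using hqu.symm

/-- A field embedding of a finite extension of `K` into `C` is continuous and does not increase
absolute values: it is a bounded linear map, and powers remove the bound. -/
theorem continuous_and_norm_le_of_algHom (F : IntermediateField K C) [FiniteDimensional K F]
    (σ : F →ₐ[K] C) : Continuous σ ∧ ∀ x, ‖σ x‖ ≤ ‖(x : C)‖ := by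
  have hfin : Module.Finite K (Subalgebra.toSubmodule F.toSubalgebra) :=
    inferInstanceAs (Module.Finite K F)
  let f : Subalgebra.toSubmodule F.toSubalgebra →L[K] C :=
    LinearMap.toContinuousLinearMap (σ.toLinearMap : F →ₗ[K] C)
  have hf : ∀ x : F, ‖σ x‖ ≤ ‖f‖ * ‖(x : C)‖ := fun x => f.le_opNorm x
  refine ⟨f.continuous, fun x => ?_⟩
  by_contra! hlt
  have hx : x ≠ 0 := fun h => by simp [h] at hlt
  have hxpos : 0 < ‖(x : C)‖ := norm_pos_iff.mpr (by exact_mod_cast hx)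
  obtain ⟨n, hn⟩ := pow_unbounded_of_one_lt ‖f‖ ((one_lt_div hxpos).mpr hlt)
  rw [div_pow, lt_div_iff₀ (by positivity)] at hn
  have := hf (x ^ n)
  rw [map_pow, norm_pow] at this
  push_cast at this
  rw [norm_pow] at this
  exact absurd this (not_le.mpr hn)

/-- Conjugates over `E` of a zero of a series with coefficients in `E` are zeros, and do not have
larger absolute value. -/
theorem isZeroOf_of_conj (E : IntermediateField K C) [FiniteDimensional K E] {a : ℕ → C}
    (haE : ∀ d, a d ∈ E) {β β' : C} (hβ : IsZeroOf a β) (hint : IsIntegral E β)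
    (hconj : Polynomial.aeval β' (minpoly E β) = 0) : IsZeroOf a β' ∧ ‖β'‖ ≤ ‖β‖ := by
  set F := IntermediateField.adjoin E {β} with hF
  have hFfin : FiniteDimensional E F := IntermediateField.adjoin.finiteDimensional hint
  let σ : F →ₐ[E] C := (IntermediateField.algHomAdjoinIntegralEquiv E hint).symm
    ⟨β', (Polynomial.mem_aroots).mpr ⟨minpoly.ne_zero hint, hconj⟩⟩
  let b : F := IntermediateField.AdjoinSimple.gen E β
  have hσ : σ b = β' := IntermediateField.algHomAdjoinIntegralEquiv_symm_apply_gen E hint _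
  have hb : (b : C) = β := IntermediateField.AdjoinSimple.coe_gen E β
  have hFK : FiniteDimensional K (F.restrictScalars K) := Module.Finite.trans (R := K) E F
  obtain ⟨hcont, hnorm⟩ := continuous_and_norm_le_of_algHom (F.restrictScalars K)
    (σ.restrictScalars K)
  have hb0 : b ≠ 0 := fun h => hβ.1 (by rw [← hb, h]; rfl)
  refine ⟨⟨by rw [← hσ]; simpa using hb0, ?_⟩, by rw [← hσ, ← hb]; exact hnorm b⟩
  -- the series already converges to zero in `F`
  have hsum : HasSum (fun d => algebraMap E F ⟨a d, haE d⟩ * b⁻¹ ^ d) 0 := by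
    rw [← Topology.IsInducing.hasSum_iff (g := F.val) Topology.IsInducing.subtypeVal]
    convert hβ.2 using 1
    · ext d
      simp [hb]
    · exact map_zero _
  have := hsum.map (σ : F →+* C) hcont
  rw [map_zero] at this
  convert this using 2 with d
  simp [hσ]

/-- A zero whose reciprocal is the only one of its absolute value is totally inseparable: its
conjugates are zeros of the same absolute value. -/
theorem totallyInseparable_of_subsingleton [IsUltrametricDist C] [IsAlgClosed C]
    (E : IntermediateField K C) [FiniteDimensional K E] {a : ℕ → C} (haE : ∀ d, a d ∈ E)
    (hne : ∃ d, a d ≠ 0) {β : C} (hβ : IsZeroOf a β)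
    (hsub : {l : C | IsZeroOf a l⁻¹ ∧ ‖l‖ = ‖β⁻¹‖}.Subsingleton) :
    TotallyInseparable E β := by
  have halg : IsAlgebraic E β :=
    inv_inv β ▸ (isAlgebraic_of_hasSum_zero E haE hne (inv_ne_zero hβ.1) hβ.2).inv
  have hint : IsIntegral E β := halg.isIntegral
  have hroot : ∀ β', Polynomial.aeval β' (minpoly E β) = 0 → β' = β := by
    intro β' hβ'
    obtain ⟨hz, hle⟩ := isZeroOf_of_conj E haE hβ hint hβ'
    have hmin : minpoly E β' = minpoly E β :=
      (minpoly.eq_of_irreducible_of_monic (minpoly.irreducible hint) hβ' (minpoly.monic hint)).symm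
    have hint' : IsIntegral E β' := by
      by_contra h
      rw [minpoly.eq_zero h] at hmin
      exact minpoly.ne_zero hint hmin.symm
    have hge := (isZeroOf_of_conj E haE hz hint' (hmin ▸ minpoly.aeval E β)).2
    have h1 := hsub (x := β'⁻¹) (y := β⁻¹) ⟨by rwa [inv_inv], by simp [le_antisymm hle hge]⟩
      ⟨by rwa [inv_inv], rfl⟩
    exact inv_injective h1
  classical
  rw [TotallyInseparable,
    IntermediateField.isPurelyInseparable_adjoin_simple_iff_natSepDegree_eq_one,
    Polynomial.natSepDegree_eq_of_isAlgClosed (E := C), Finset.card_eq_one]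
  refine ⟨β, ?_⟩
  ext x
  simp only [Multiset.mem_toFinset, Polynomial.mem_aroots, Finset.mem_singleton]
  exact ⟨fun h => hroot x h.2, fun h => ⟨minpoly.ne_zero hint, h ▸ minpoly.aeval E β⟩⟩

/-- The conclusions about zeros hold for every entire series with coefficients in a finite
extension `E` of `K`. -/
theorem totallyInseparable_and_finiteSeparablePart [CompleteSpace C] [IsUltrametricDist C]
    [IsAlgClosed C]
    (E : IntermediateField K C) [FiniteDimensional K E] {a : ℕ → C} (haE : ∀ d, a d ∈ E)
    (hent : IsEntire a) {b : ℝ} (hb : IsGRHBound a b) :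
    (∀ β : C, IsZeroOf a β → b < 1 / ‖β‖ → TotallyInseparable E β) ∧
      FiniteSeparablePart E a := by
  obtain ⟨t₀, ht₀⟩ := NormedField.exists_lt_norm K b
  set t : C := algebraMap K C t₀ with ht
  have htn : b < ‖t‖ := by rwa [ht, norm_algebraMap']
  have ht0 : t ≠ 0 := norm_pos_iff.mp (hb.1.trans htn)
  -- the zero series has many zeros of the same absolute value
  have hne : ∃ d, a d ≠ 0 := by
    by_contra! h0
    obtain ⟨s₀, hs₀pos, hs₀⟩ := NormedField.exists_norm_lt_one K
    set s : C := algebraMap K C s₀ with hs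
    have hsn : ‖s‖ < 1 := by rwa [hs, norm_algebraMap']
    have hs0 : s ≠ 0 := norm_pos_iff.mp (by rwa [hs, norm_algebraMap'])
    have h1s : ‖1 + s‖ = 1 := by
      rw [IsUltrametricDist.norm_add_eq_max_of_norm_ne_norm (by rw [norm_one]; exact hsn.ne'),
        norm_one]
      exact max_eq_left hsn.le
    have hz : ∀ l : C, l ≠ 0 → IsZeroOf a l⁻¹ := fun l hl =>
      ⟨inv_ne_zero hl, by simp [h0]⟩
    have h1s0 : 1 + s ≠ 0 := norm_pos_iff.mp (by rw [h1s]; norm_num)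
    have := hb.2 ‖t‖ htn.le (x := t) (y := t * (1 + s)) ⟨hz _ ht0, rfl⟩
      ⟨hz _ (mul_ne_zero ht0 h1s0), by rw [norm_mul, h1s, mul_one]⟩
    rw [left_eq_mul₀ ht0] at this
    exact hs0 (by simpa only [add_eq_left] using this)
  have hins : ∀ β : C, IsZeroOf a β → b < 1 / ‖β‖ → TotallyInseparable E β := by
    intro β hβ hlt
    refine totallyInseparable_of_subsingleton E haE hne hβ ?_
    have h1 : 1 / ‖β‖ = ‖β⁻¹‖ := by rw [norm_inv, one_div]
    exact hb.2 _ (h1 ▸ hlt.le)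
  refine ⟨hins, ?_⟩
  have h : FiniteDimensional E (separableClosure E (zeroField E a)) :=
    finiteDimensional_separableClosure_adjoin E (Z := {β | IsZeroOf a β})
    (Z₀ := {β | IsZeroOf a β ∧ 1 / ‖β‖ ≤ b}) ?_ ?_ fun β hβ h0 => hins β hβ ?_
  · exact FiniteDimensional.trans K E (separableClosure E (zeroField E a))
  · refine ((hent.finite_zeros hne ht0).image (·⁻¹)).subset fun β hβ => ⟨β⁻¹, ⟨?_, hβ.1.2⟩, ?_⟩
    · rw [norm_inv, ← one_div]; exact hβ.2.trans htn.le
    · exact inv_inv β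
  · intro β hβ
    exact (inv_inv β ▸
      (isAlgebraic_of_hasSum_zero E haE hne (inv_ne_zero hβ.1.1) hβ.1.2).inv).isIntegral
  · by_contra hlt
    exact h0 ⟨hβ, not_lt.mp hlt⟩

end Algebraicity

/-! ### One-units and roots of unity in characteristic `p` -/

section OneUnits

variable {C : Type*} [NormedField C] [IsUltrametricDist C]

theorem norm_eq_one_of_norm_sub_one_lt {u : C} (hu : ‖u - 1‖ < 1) : ‖u‖ = 1 := by
  have h : u = (u - 1) + 1 := by ring
  rw [h, IsUltrametricDist.norm_add_eq_max_of_norm_ne_norm (by rw [norm_one]; exact hu.ne),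
    norm_one]
  exact max_eq_right hu.le

theorem norm_mul_sub_one_lt {u w : C} (hu : ‖u - 1‖ < 1) (hw : ‖w - 1‖ < 1) :
    ‖u * w - 1‖ < 1 := by
  have h : u * w - 1 = u * (w - 1) + (u - 1) := by ring
  rw [h]
  refine (IsUltrametricDist.norm_add_le_max _ _).trans_lt (max_lt ?_ hu)
  rwa [norm_mul, norm_eq_one_of_norm_sub_one_lt hu, one_mul]

theorem norm_inv_sub_one_lt {u : C} (hu : ‖u - 1‖ < 1) : ‖u⁻¹ - 1‖ < 1 := by
  have h1 := norm_eq_one_of_norm_sub_one_lt hu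
  have h0 : u ≠ 0 := norm_pos_iff.mp (by rw [h1]; norm_num)
  have h : u⁻¹ - 1 = -(u⁻¹ * (u - 1)) := by field_simp; ring
  rw [h, norm_neg, norm_mul, norm_inv, h1, inv_one, one_mul]
  exact hu

theorem norm_pow_sub_one_le {u : C} (hu : ‖u‖ ≤ 1) (n : ℕ) : ‖u ^ n - 1‖ ≤ ‖u - 1‖ := by
  induction n with
  | zero => simp
  | succ n ih =>
    have h : u ^ (n + 1) - 1 = u * (u ^ n - 1) + (u - 1) := by ring
    rw [h]
    refine (IsUltrametricDist.norm_add_le_max _ _).trans (max_le ?_ le_rfl)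
    rw [norm_mul]
    exact (mul_le_of_le_one_left (norm_nonneg _) hu).trans ih

/-- If a monic polynomial takes a small value at `x`, it has a root congruent to `x`. -/
theorem exists_root_norm_sub_lt {C : Type*} [NormedField C] [IsAlgClosed C] {P : Polynomial C}
    (hP : P.Monic) {x : C} (hx : ‖P.eval x‖ < 1) : ∃ w, P.IsRoot w ∧ ‖x - w‖ < 1 := by
  by_contra! hall
  rw [(IsAlgClosed.splits P).eval_eq_prod_roots_of_monic hP] at hx
  have h := map_multiset_prod (normHom : C →*₀ ℝ) (P.roots.map (x - ·))
  rw [Multiset.map_map] at h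
  refine absurd (h.symm.trans_lt hx) (not_lt.mpr (Multiset.one_le_prod fun r hr => ?_))
  obtain ⟨w, hw, rfl⟩ := Multiset.mem_map.mp hr
  exact hall w (Polynomial.isRoot_of_mem_roots hw)

theorem exists_oneUnit_pow_eq {C : Type*} [NormedField C] [IsAlgClosed C]
    {z : C} (hz : ‖z - 1‖ < 1) {e : ℕ} (he : e ≠ 0) :
    ∃ u : C, ‖u - 1‖ < 1 ∧ u ^ e = z := by
  obtain ⟨w, hw, hlt⟩ := exists_root_norm_sub_lt (Polynomial.monic_X_pow_sub_C z he) (x := 1)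
    (by simpa [norm_sub_rev] using hz)
  exact ⟨w, by rwa [norm_sub_rev], by simpa [sub_eq_zero] using hw⟩

/-- In characteristic `p` every root of unity is fixed by a power of the Frobenius map. -/
theorem exists_frobenius_fix (p : ℕ) [Fact p.Prime] {R : Type*} [CommRing R] [IsReduced R]
    [CharP R p] {ω : R} {n : ℕ} (hn : n ≠ 0) (hω : ω ^ n = 1) : ∃ f : ℕ, f ≠ 0 ∧ ω ^ p ^ f = ω := by
  have hp : p.Prime := Fact.out
  obtain ⟨s, m, hm, rfl⟩ := Nat.exists_eq_pow_mul_and_not_dvd hn p hp.ne_one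
  have : ExpChar R p := ExpChar.prime hp
  have h1 : ω ^ m = 1 := by
    rw [mul_comm, pow_mul] at hω
    have h2 : (ω ^ m - 1) ^ p ^ s = 0 := by rw [sub_pow_expChar_pow, hω, one_pow, sub_self]
    exact sub_eq_zero.mp (pow_eq_zero_iff (pow_ne_zero _ hp.ne_zero) |>.mp h2)
  have hm0 : 0 < m := Nat.pos_of_ne_zero fun h => hm (h ▸ dvd_zero p)
  refine ⟨m.totient, (Nat.totient_pos.mpr hm0).ne', ?_⟩
  have h3 := (Nat.modEq_iff_dvd' (Nat.one_le_pow _ _ hp.pos)).mp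
    (Nat.ModEq.pow_totient ((Nat.Prime.coprime_iff_not_dvd hp).mpr hm)).symm
  obtain ⟨k, hk⟩ := h3
  have h4 : p ^ m.totient = m * k + 1 := by
    have := Nat.one_le_pow m.totient p hp.pos
    omega
  rw [h4, pow_succ, pow_mul, h1, one_pow, one_mul]

/-- If `ω` is fixed by the `p ^ f`-power map, iterating this map on any `x` congruent to `ω`
converges to `ω`. -/
theorem tendsto_pow_frobenius {C : Type*} [NormedField C] (p : ℕ) [Fact p.Prime] [CharP C p]
    {x ω : C} (hx : ‖x - ω‖ < 1) {f : ℕ} (hf : f ≠ 0)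
    (hω : ω ^ p ^ f = ω) : Tendsto (fun n : ℕ => x ^ p ^ (f * n)) atTop (𝓝 ω) := by
  have hp : p.Prime := Fact.out
  have : ExpChar C p := ExpChar.prime hp
  have hfix : ∀ n, ω ^ p ^ (f * n) = ω := fun n => by
    induction n with
    | zero => simp
    | succ n ih => rw [mul_add, mul_one, pow_add, pow_mul, ih, hω]
  rw [tendsto_iff_norm_sub_tendsto_zero]
  have h1 : ∀ n, ‖x ^ p ^ (f * n) - ω‖ ≤ ‖x - ω‖ ^ n := fun n => by
    conv_lhs => rw [← hfix n]
    rw [← sub_pow_expChar_pow, norm_pow]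
    refine pow_le_pow_of_le_one (norm_nonneg _) hx.le ?_
    calc n ≤ f * n := Nat.le_mul_of_pos_left _ (Nat.pos_of_ne_zero hf)
      _ ≤ p ^ (f * n) := (Nat.lt_pow_self hp.one_lt).le
  exact squeeze_zero (fun _ => norm_nonneg _) h1
    (tendsto_pow_atTop_nhds_zero_of_lt_one (norm_nonneg _) hx)

theorem oneUnit_eq_one_of_pow_eq_one (p : ℕ) [Fact p.Prime] [CharP C p] {u : C}
    (hu : ‖u - 1‖ < 1) {e : ℕ} (he : e ≠ 0) (h : u ^ e = 1) : u = 1 := by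
  obtain ⟨f, hf, hfix⟩ := exists_frobenius_fix p he h
  have h1 := tendsto_pow_frobenius p hu hf (one_pow _)
  have h2 := tendsto_pow_frobenius p (x := u) (ω := u) (by simp) hf hfix
  exact tendsto_nhds_unique h2 h1

theorem oneUnit_eq_of_pow_eq (p : ℕ) [Fact p.Prime] [CharP C p] {u w : C}
    (hu : ‖u - 1‖ < 1) (hw : ‖w - 1‖ < 1) {e : ℕ} (he : e ≠ 0) (h : u ^ e = w ^ e) : u = w := by
  have hw0 : w ≠ 0 := norm_pos_iff.mp (by rw [norm_eq_one_of_norm_sub_one_lt hw]; norm_num)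
  have h1 := oneUnit_eq_one_of_pow_eq_one p (norm_mul_sub_one_lt hu (norm_inv_sub_one_lt hw)) he
    (by rw [mul_pow, h, ← mul_pow, mul_inv_cancel₀ hw0, one_pow])
  exact mul_inv_eq_one₀ hw0 |>.mp h1

/-- A root of unity congruent to an element of a closed set stable under powers lies in it. -/
theorem rootOfUnity_mem {C : Type*} [NormedField C] (p : ℕ) [Fact p.Prime] [CharP C p]
    {s : Set C} (hs : IsClosed s) (hpow : ∀ x ∈ s, ∀ n : ℕ, x ^ n ∈ s) {x ω : C} (hx : x ∈ s)
    (h : ‖x - ω‖ < 1) {n : ℕ} (hn : n ≠ 0) (hω : ω ^ n = 1) : ω ∈ s := by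
  obtain ⟨f, hf, hfix⟩ := exists_frobenius_fix p hn hω
  exact hs.mem_of_tendsto (tendsto_pow_frobenius p h hf hfix)
    (Eventually.of_forall fun n => hpow x hx _)

theorem norm_pow_mul_sub_one_le (p : ℕ) [Fact p.Prime] [CharP C p] {u : C}
    (hu : ‖u - 1‖ < 1) (m k : ℕ) : ‖u ^ (p ^ m * k) - 1‖ ≤ ‖u - 1‖ ^ m := by
  have hp : p.Prime := Fact.out
  have : ExpChar C p := ExpChar.prime hp
  have h1 := norm_eq_one_of_norm_sub_one_lt hu
  rw [pow_mul]
  refine (norm_pow_sub_one_le (by rw [norm_pow, h1, one_pow]) k).trans ?_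
  have h2 : u ^ p ^ m - 1 = (u - 1) ^ p ^ m := by rw [sub_pow_expChar_pow, one_pow]
  rw [h2, norm_pow]
  exact pow_le_pow_of_le_one (norm_nonneg _) hu.le (Nat.lt_pow_self hp.one_lt).le

/-- The powers of a one-unit along exponents `N 0, N 1, …` with `N (m + 1) ≡ N m` mod `p ^ m`
converge. -/
theorem cauchySeq_pow (p : ℕ) [Fact p.Prime] [CharP C p] {u : C} (hu : ‖u - 1‖ < 1) {N : ℕ → ℕ}
    (hN : ∀ m, ∃ k, N (m + 1) = N m + p ^ m * k) : CauchySeq fun m => u ^ N m := by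
  refine cauchySeq_of_le_geometric ‖u - 1‖ 1 hu fun m => ?_
  obtain ⟨k, hk⟩ := hN m
  rw [dist_comm, dist_eq_norm, hk, pow_add]
  have h : u ^ N m * u ^ (p ^ m * k) - u ^ N m = u ^ N m * (u ^ (p ^ m * k) - 1) := by ring
  rw [h, norm_mul, norm_pow, norm_eq_one_of_norm_sub_one_lt hu, one_pow]
  gcongr
  exact norm_pow_mul_sub_one_le p hu m k

/-- A closed set stable under powers contains the `p`-adic powers of its one-units. -/
theorem padicPow_mem (p : ℕ) [Fact p.Prime] [CharP C p]
    [CompleteSpace C] {s : Set C} (hs : IsClosed s)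
    (hpow : ∀ x ∈ s, ∀ n : ℕ, x ^ n ∈ s) {u : C} (hu : ‖u - 1‖ < 1) (hmem : u ∈ s)
    (y : ℤ_[p]) : padicPow u y ∈ s := by
  have hc : CauchySeq fun m => u ^ y.appr m := cauchySeq_pow p hu fun m => by
    obtain ⟨k, hk⟩ := PadicInt.dvd_appr_sub_appr y m (m + 1) m.le_succ
    have := PadicInt.appr_mono y m.le_succ
    exact ⟨k, by rw [← hk]; exact (Nat.add_sub_cancel' this).symm⟩
  exact hs.mem_of_tendsto (CauchySeq.tendsto_limUnder hc)
    (Eventually.of_forall fun m => hpow u hmem _)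

/-- One-units of a complete field are `(p ^ f - 1)`-th powers: `u⁻¹` is the limit of
`u ^ (p ^ (f * n) - 1)`, whose exponents are divisible by `p ^ f - 1`. -/
theorem exists_pow_eq_of_oneUnit (p : ℕ) [Fact p.Prime] [CharP C p]
    [CompleteSpace C] {u : C} (hu : ‖u - 1‖ < 1) {f : ℕ}
    (hf : f ≠ 0) : ∃ w : C, w ^ (p ^ f - 1) = u := by
  have hp : p.Prime := Fact.out
  set q := p ^ f with hq
  have hc : CauchySeq fun m => u ^ (∑ i ∈ Finset.range m, q ^ i) := cauchySeq_pow p hu fun m => by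
    refine ⟨p ^ (f * m - m), ?_⟩
    rw [Finset.sum_range_succ, ← pow_add, Nat.add_sub_cancel'
      (Nat.le_mul_of_pos_left _ (Nat.pos_of_ne_zero hf)), hq, ← pow_mul]
  have h1 := (CauchySeq.tendsto_limUnder hc).pow (q - 1)
  have h2 := (tendsto_pow_frobenius p hu hf (one_pow _)).div_const u
  have hu0 : u ≠ 0 := norm_pos_iff.mp (by rw [norm_eq_one_of_norm_sub_one_lt hu]; norm_num)
  have h3 := tendsto_nhds_unique h1 (h2.congr fun m => by
    have hq1 : q - 1 + 1 = q := Nat.sub_add_cancel (Nat.one_le_pow _ _ hp.pos)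
    have hgeom := geom_sum_mul_add (q - 1) m
    rw [hq1] at hgeom
    rw [div_eq_iff hu0, ← pow_mul, ← pow_succ, hgeom, hq, ← pow_mul])
  exact ⟨_⁻¹, by rw [inv_pow, h3, one_div, inv_inv]⟩

end OneUnits

/-! ### The affine ring as a finite extension of a polynomial ring -/


section Integrality

/-- An element of a field that lies in all valuation rings containing `R` is integral over `R`. -/
theorem isIntegral_of_forall_valuationSubring {R k : Type*} [CommRing R] [Field k] [Algebra R k]
    {x : k} (h : ∀ O : ValuationSubring k, (∀ r, algebraMap R k r ∈ O) → x ∈ O) :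
    IsIntegral R x := by
  have h1 : x ∈ (integralClosure (Subring.closure (Set.range (algebraMap R k))) k).toSubring := by
    rw [← iInf_valuationSubring_superset, Subring.mem_iInf]
    rintro ⟨O, hO⟩
    exact h O fun r => hO ⟨r, rfl⟩
  have h2 : Subring.closure (Set.range (algebraMap R k)) = (algebraMap R k).range := by
    rw [← RingHom.coe_range, Subring.closure_eq]
  have h3 : IsIntegral (Subring.closure (Set.range (algebraMap R k))) x := h1
  obtain ⟨P, hP, hPx⟩ := h3
  have hlift : P.map (algebraMap _ k) ∈ Polynomial.lifts (algebraMap R k) := by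
    rw [Polynomial.lifts_iff_coeff_lifts]
    intro n
    rw [Polynomial.coeff_map]
    exact h2.le (P.coeff n).2
  obtain ⟨Q, hQ, -, hQm⟩ := Polynomial.lifts_and_degree_eq_and_monic hlift (hP.map _)
  refine ⟨Q, hQm, ?_⟩
  rw [← Polynomial.eval_map, hQ, Polynomial.eval_map]
  exact hPx

theorem algebraMap_mem_valuationSubring {F k : Type*} [Field F] [Finite F] [Field k] [Algebra F k]
    (O : ValuationSubring k) (c : F) : algebraMap F k c ∈ O := by
  rcases O.mem_or_inv_mem (algebraMap F k c) with h | h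
  · exact h
  by_cases hc : c = 0
  · rw [hc, map_zero]; exact O.zero_mem
  have : Fintype F := Fintype.ofFinite F
  have h1 : c = (c⁻¹) ^ (Fintype.card F - 2) := by
    have h2 := FiniteField.pow_card_sub_one_eq_one c hc
    have h3 : Fintype.card F - 1 = (Fintype.card F - 2) + 1 := by
      have := Fintype.one_lt_card (α := F); omega
    rw [h3, pow_succ] at h2
    rw [inv_pow]
    exact eq_inv_of_mul_eq_one_right h2
  rw [h1, map_pow, map_inv₀]
  exact pow_mem h _

variable {Fr A k : Type*} [Field Fr] [Finite Fr] [CommRing A] [IsDedekindDomain A] [Field k]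
  [Algebra Fr A] [Algebra A k] [Algebra Fr k] [IsScalarTower Fr A k] [IsFractionRing A k]
  {inf : ValuationSubring k}

theorem IsAffineRingAway.exists_notMem (hA : IsAffineRingAway Fr A k inf) :
    ∃ t : A, algebraMap A k t ∉ inf := by
  by_contra! h
  exact (hA.contains_iff inf).mp h rfl

/-- The functions regular on the whole curve are the constants. -/
theorem IsAffineRingAway.exists_const (hA : IsAffineRingAway Fr A k inf) {a : A}
    (ha : algebraMap A k a ∈ inf) : ∃ c : Fr, algebraMap Fr A c = a := by
  have h1 : IsIntegral Fr (algebraMap A k a) := isIntegral_of_forall_valuationSubring fun O _ => by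
    by_cases hO : O = inf
    · rwa [hO]
    · exact (hA.contains_iff O).mpr hO a
  obtain ⟨c, hc⟩ := (isIntegrallyClosedIn_iff.mp hA.constants).2 h1
  exact ⟨c, IsFractionRing.injective A k (by rw [← IsScalarTower.algebraMap_apply, hc])⟩

theorem aeval_injective_of_notMem {t : A}
    (ht : algebraMap A k t ∉ inf) : Function.Injective (aeval t : Fr[X] →ₐ[Fr] A) := by
  rw [injective_iff_map_eq_zero]
  intro f hf
  by_contra hne
  refine ht ?_
  have h1 : IsAlgebraic Fr (algebraMap A k t) :=
    ⟨f, hne, by rw [aeval_algebraMap_apply, hf, map_zero]⟩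
  obtain ⟨P, hP, hPx⟩ := h1.isIntegral
  have h2 : IsIntegral inf (algebraMap A k t) := by
    let g : Fr →+* inf := (algebraMap Fr k).codRestrict inf.toSubring
      (algebraMap_mem_valuationSubring inf)
    refine ⟨P.map g, hP.map _, ?_⟩
    rw [eval₂_map]
    exact hPx
  obtain ⟨y, hy⟩ := IsIntegrallyClosed.isIntegral_iff.mp h2
  rw [← hy]
  exact y.2

/-- The structure of an `Fr[X]`-algebra on `A` for which `X` acts as `t`. -/
@[reducible] def polyAlgebra (Fr : Type*) {A : Type*} [CommSemiring Fr] [CommSemiring A]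
    [Algebra Fr A] (t : A) : Algebra Fr[X] A := (aeval t : Fr[X] →ₐ[Fr] A).toAlgebra

/-- For `t` with a pole at `∞`, the ring `A` is finite over `Fr[t]`: every valuation ring
containing `Fr[t]` differs from the one at `∞`, so contains `A`. -/
theorem IsAffineRingAway.finite_polyAlgebra (hA : IsAffineRingAway Fr A k inf) {t : A}
    (ht : algebraMap A k t ∉ inf) : let _ := polyAlgebra Fr t; Module.Finite Fr[X] A := by
  let _ := polyAlgebra Fr t
  let _ : Algebra Fr[X] k := ((algebraMap A k).comp (algebraMap Fr[X] A)).toAlgebra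
  have : IsScalarTower Fr[X] A k := IsScalarTower.of_algebraMap_eq fun _ => rfl
  have : IsScalarTower Fr Fr[X] A := IsScalarTower.of_algebraMap_eq fun c =>
    (aeval_C (R := Fr) t c).symm
  have hint : Algebra.IsIntegral Fr[X] A := ⟨fun a => by
    rw [← isIntegral_algebraMap_iff (IsFractionRing.injective A k)]
    refine isIntegral_of_forall_valuationSubring fun O hO => ?_
    refine (hA.contains_iff O).mpr (fun h => ht ?_) a
    have := hO X
    rw [h] at this
    change algebraMap A k (aeval t X) ∈ inf at this
    rwa [aeval_X] at this⟩
  have := hA.finiteType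
  have : Algebra.FiniteType Fr[X] A := Algebra.FiniteType.of_restrictScalars_finiteType Fr Fr[X] A
  exact Algebra.IsIntegral.finite

theorem IsAffineRingAway.finite_classGroup (hA : IsAffineRingAway Fr A k inf) :
    Finite (ClassGroup A) := by
  obtain ⟨t, ht⟩ := hA.exists_notMem
  let _ := polyAlgebra Fr t
  have hfin : Module.Finite Fr[X] A := hA.finite_polyAlgebra ht
  have htf : Module.IsTorsionFree Fr[X] A :=
    Module.isTorsionFree_iff_algebraMap_injective.mpr (aeval_injective_of_notMem ht)
  have hfree : Module.Free Fr[X] A := Module.free_of_finite_type_torsion_free'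
  classical
  have : Fintype Fr := Fintype.ofFinite Fr
  have := ClassGroup.fintypeOfAdmissibleOfAlgebraic (Module.Free.chooseBasis Fr[X] A)
    (Polynomial.cardPowDegreeIsAdmissible (Fq := Fr))
  infer_instance

end Integrality

/-! ### The place at infinity: constants, residues and approximation -/

section Constants

theorem norm_sum_lt {ι K : Type*} [NormedField K] [IsUltrametricDist K] {s : Finset ι} {f : ι → K}
    {B : ℝ} (hB : 0 < B) (h : ∀ i ∈ s, ‖f i‖ < B) : ‖∑ i ∈ s, f i‖ < B := by
  classical
  induction s using Finset.induction_on with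
  | empty => simpa
  | insert i s hi ih =>
    rw [Finset.sum_insert hi]
    exact (IsUltrametricDist.norm_add_le_max _ _).trans_lt (max_lt (h i (by simp))
      (ih fun j hj => h j (by simp [hj])))

/-- A nonzero root of a nonzero polynomial over a finite field is a root of unity. -/
theorem exists_pow_eq_one_of_root {F R : Type*} [Field F] [Finite F] [Field R] (f : F →+* R)
    {P : F[X]} (hP : P ≠ 0) {w : R} (hw : P.eval₂ f w = 0) (hw0 : w ≠ 0) :
    ∃ n : ℕ, n ≠ 0 ∧ w ^ n = 1 := by
  let _ : Algebra F R := f.toAlgebra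
  have halg : IsIntegral F w := IsAlgebraic.isIntegral ⟨P, hP, hw⟩
  have := IntermediateField.adjoin.finiteDimensional halg
  have : Finite (IntermediateField.adjoin F {w}) := Module.finite_of_finite F
  let g := IntermediateField.AdjoinSimple.gen F w
  have hg : (g : R) = w := IntermediateField.AdjoinSimple.coe_gen F w
  have hg0 : g ≠ 0 := fun h => hw0 (by rw [← hg, h]; rfl)
  obtain ⟨n, hn, h1⟩ := (isOfFinOrder_iff_pow_eq_one).mp (isOfFinOrder_of_finite (Units.mk0 g hg0))
  refine ⟨n, hn.ne', ?_⟩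
  have := congrArg (fun x : (IntermediateField.adjoin F {w})ˣ =>
    ((x : IntermediateField.adjoin F {w}) : R)) h1
  simpa [hg] using this

variable {F K : Type*} [Field F] [Finite F] [NormedField K] [Algebra F K]

theorem exists_pow_eq_one_of_isAlgebraic {w : K} (hw : IsAlgebraic F w) (hw0 : w ≠ 0) :
    ∃ n : ℕ, n ≠ 0 ∧ w ^ n = 1 := by
  obtain ⟨P, hP, h⟩ := hw
  exact exists_pow_eq_one_of_root (algebraMap F K) hP h hw0

theorem norm_eq_one_of_isAlgebraic {w : K} (hw : IsAlgebraic F w) (hw0 : w ≠ 0) : ‖w‖ = 1 := by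
  obtain ⟨n, hn, h⟩ := exists_pow_eq_one_of_isAlgebraic hw hw0
  exact (pow_eq_one_iff_of_nonneg (norm_nonneg w) hn).mp (by rw [← norm_pow, h, norm_one])

theorem norm_const_le_one (c : F) : ‖algebraMap F K c‖ ≤ 1 := by
  by_cases h : algebraMap F K c = 0
  · rw [h, norm_zero]; norm_num
  · exact (norm_eq_one_of_isAlgebraic (isAlgebraic_algebraMap c) h).le

theorem norm_const_of_ne_zero {c : F} (hc : c ≠ 0) : ‖algebraMap F K c‖ = 1 :=
  norm_eq_one_of_isAlgebraic (isAlgebraic_algebraMap c) (by simpa using hc)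

theorem eq_of_isAlgebraic_of_norm_sub_lt {w w' : K} (hw : IsAlgebraic F w)
    (hw' : IsAlgebraic F w') (h : ‖w - w'‖ < 1) : w = w' := by
  by_contra hne
  exact h.ne (norm_eq_one_of_isAlgebraic (hw.sub hw') (sub_ne_zero.mpr hne))

theorem norm_aeval_sub_aeval_le [IsUltrametricDist K] {x x' : K} (hx : ‖x‖ ≤ 1) (hx' : ‖x'‖ ≤ 1)
    (f : F[X]) : ‖aeval x f - aeval x' f‖ ≤ ‖x - x'‖ := by
  rw [aeval_eq_sum_range, aeval_eq_sum_range, ← Finset.sum_sub_distrib]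
  refine IsUltrametricDist.norm_sum_le_of_forall_le_of_nonneg (norm_nonneg _) fun i _ => ?_
  rw [Algebra.smul_def, Algebra.smul_def, ← mul_sub, norm_mul]
  refine (mul_le_of_le_one_left (norm_nonneg _) (norm_const_le_one _)).trans ?_
  induction i with
  | zero => simp
  | succ i ih =>
    have h : x ^ (i + 1) - x' ^ (i + 1) = x ^ i * (x - x') + (x ^ i - x' ^ i) * x' := by ring
    rw [h]
    refine (IsUltrametricDist.norm_add_le_max _ _).trans (max_le ?_ ?_)
    · rw [norm_mul, norm_pow]
      exact mul_le_of_le_one_left (norm_nonneg _) (pow_le_one₀ (norm_nonneg _) hx)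
    · rw [norm_mul]
      exact (mul_le_of_le_one_right (norm_nonneg _) hx').trans
        (ih (by simp only [Finset.mem_range] at *; omega))

/-- For `x` of absolute value larger than `1`, a polynomial of degree at most `d` with constant
coefficients is, up to a factor `x ^ d`, congruent to its coefficient of degree `d`. -/
theorem norm_aeval_sub_leading_lt [IsUltrametricDist K] {x : K} (hx : 1 < ‖x‖) {f : F[X]} {d : ℕ}
    (hf : f.natDegree ≤ d) : ‖aeval x f - algebraMap F K (f.coeff d) * x ^ d‖ < ‖x‖ ^ d := by
  rw [aeval_eq_sum_range' (Nat.lt_succ_of_le hf), Finset.sum_range_succ, Algebra.smul_def,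
    add_sub_cancel_right]
  rcases Nat.eq_zero_or_pos d with rfl | hd
  · simp
  refine lt_of_le_of_lt (IsUltrametricDist.norm_sum_le_of_forall_le_of_nonneg
    (C := ‖x‖ ^ (d - 1)) (by positivity) fun i hi => ?_) (pow_lt_pow_right₀ hx (by omega))
  rw [Algebra.smul_def, norm_mul, norm_pow]
  refine (mul_le_of_le_one_left (by positivity) (norm_const_le_one _)).trans
    (pow_le_pow_right₀ hx.le ?_)
  simp only [Finset.mem_range] at hi
  omega

theorem norm_aeval_eq [IsUltrametricDist K] {x : K} (hx : 1 < ‖x‖) {f : F[X]} (hf : f ≠ 0) :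
    ‖aeval x f‖ = ‖x‖ ^ f.natDegree := by
  have h1 := norm_aeval_sub_leading_lt hx (le_refl f.natDegree)
  have h2 : ‖algebraMap F K (f.coeff f.natDegree) * x ^ f.natDegree‖ = ‖x‖ ^ f.natDegree := by
    rw [norm_mul, norm_pow, norm_const_of_ne_zero (by simpa using hf), one_mul]
  rw [← h2] at h1 ⊢
  have h3 := IsUltrametricDist.norm_add_eq_max_of_norm_ne_norm h1.ne
  rw [sub_add_cancel] at h3
  rw [h3]
  exact max_eq_right h1.le

end Constants

section Infinity

variable {Fr A k K : Type*} [Field Fr] [Finite Fr] [CommRing A] [IsDedekindDomain A] [Field k]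
  [Algebra Fr A] [Algebra A k] [Algebra Fr k] [IsScalarTower Fr A k] [IsFractionRing A k]
  {inf : ValuationSubring k} [NontriviallyNormedField K] [Algebra k K] [Algebra Fr K]
  [IsScalarTower Fr k K]

theorem IsCompletionAt.exists_norm_sub_lt (hK : IsCompletionAt inf K) (z : K) {ε : ℝ}
    (hε : 0 < ε) : ∃ x : k, ‖z - algebraMap k K x‖ < ε := by
  obtain ⟨x, hx⟩ := hK.dense.exists_dist_lt z hε
  exact ⟨x, by rwa [dist_eq_norm] at hx⟩

theorem IsCompletionAt.exists_one_lt_norm (hA : IsAffineRingAway Fr A k inf)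
    (hK : IsCompletionAt inf K) :
    ∃ t : A, algebraMap A k t ∉ inf ∧ 1 < ‖algebraMap k K (algebraMap A k t)‖ := by
  obtain ⟨t, ht⟩ := hA.exists_notMem
  exact ⟨t, ht, by rw [← not_le, hK.norm_le_one_iff]; exact ht⟩

/-- Every element of `k` is a quotient of an element of `A` by a polynomial in `t`. -/
theorem IsAffineRingAway.exists_eq_div (hA : IsAffineRingAway Fr A k inf) {t : A}
    (ht : algebraMap A k t ∉ inf) (z : k) :
    ∃ (b : A) (f : Fr[X]), f ≠ 0 ∧ z * algebraMap A k (aeval t f) = algebraMap A k b := by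
  let _ := polyAlgebra Fr t
  have hfin : Module.Finite Fr[X] A := hA.finite_polyAlgebra ht
  have htf : Module.IsTorsionFree Fr[X] A :=
    Module.isTorsionFree_iff_algebraMap_injective.mpr (aeval_injective_of_notMem ht)
  obtain ⟨b, c, hc, rfl⟩ := IsFractionRing.div_surjective (A := A) z
  have hc0 : c ≠ 0 := nonZeroDivisors.ne_zero hc
  obtain ⟨b', f, hf, h⟩ := Algebra.IsAlgebraic.exists_smul_eq_mul Fr[X] b hc0
  refine ⟨b', f, hf, ?_⟩
  have h1 : aeval t f * b = c * b' := h
  have hc' : algebraMap A k c ≠ 0 := by simpa using hc0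
  field_simp
  rw [← map_mul, ← map_mul, mul_comm b, h1]

/-- The elements of `A` approximate all of `k` up to a bounded error, that is
`k = A + {‖z‖ ≤ B}`: this holds for polynomials in `t` by division with remainder. -/
theorem IsAffineRingAway.exists_bounded_error (hA : IsAffineRingAway Fr A k inf)
    (hK : IsCompletionAt inf K) : ∃ B : ℝ, ∀ z : k, ∃ a : A,
      ‖algebraMap k K (z - algebraMap A k a)‖ ≤ B := by
  have := hK.ultrametric
  obtain ⟨t, ht, ht1⟩ := hK.exists_one_lt_norm hA
  set x : K := algebraMap k K (algebraMap A k t) with hx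
  obtain ⟨n, e, he⟩ : ∃ (n : ℕ) (e : Fin n → A),
      ∀ a : A, ∃ g : Fin n → Fr[X], a = ∑ i, aeval t (g i) * e i := by
    let _ := polyAlgebra Fr t
    have hfin : Module.Finite Fr[X] A := hA.finite_polyAlgebra ht
    obtain ⟨n, e, he⟩ := Module.Finite.exists_fin (R := Fr[X]) (M := A)
    refine ⟨n, e, fun a => ?_⟩
    have : a ∈ Submodule.span Fr[X] (Set.range e) := by rw [he]; trivial
    obtain ⟨g, hg⟩ := (Submodule.mem_span_range_iff_exists_fun Fr[X]).mp this
    exact ⟨g, by rw [← hg]; rfl⟩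
  have hmap : ∀ f : Fr[X], algebraMap k K (algebraMap A k (aeval t f)) = aeval x f := fun f => by
    rw [← aeval_algebraMap_apply, hx, ← aeval_algebraMap_apply]
  refine ⟨∑ i, ‖algebraMap k K (algebraMap A k (e i))‖, fun z => ?_⟩
  obtain ⟨b, f, hf, hz⟩ := hA.exists_eq_div ht z
  obtain ⟨g, rfl⟩ := he b
  refine ⟨∑ i, aeval t (g i / f) * e i, ?_⟩
  have hfx : aeval x f ≠ 0 := norm_pos_iff.mp (by
    rw [norm_aeval_eq ht1 hf]; exact pow_pos (zero_lt_one.trans ht1) _)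
  have h1 : algebraMap k K (z - algebraMap A k (∑ i, aeval t (g i / f) * e i)) =
      ∑ i, (aeval x f)⁻¹ * aeval x (g i % f) * algebraMap k K (algebraMap A k (e i)) := by
    have h2 := congrArg (algebraMap k K) hz
    rw [map_mul, hmap] at h2
    rw [map_sub, eq_div_of_mul_eq hfx h2]
    simp only [map_sum, map_mul, hmap]
    rw [Finset.sum_div, ← Finset.sum_sub_distrib]
    refine Finset.sum_congr rfl fun i _ => ?_
    have h3 : aeval x (g i) = aeval x f * aeval x (g i / f) + aeval x (g i % f) := by
      rw [← map_mul, ← map_add, EuclideanDomain.div_add_mod]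
    rw [h3]
    field_simp
    ring
  rw [h1]
  refine (norm_sum_le _ _).trans (Finset.sum_le_sum fun i _ => ?_)
  rw [norm_mul]
  refine mul_le_of_le_one_left (norm_nonneg _) ?_
  rw [norm_mul, norm_inv, norm_aeval_eq ht1 hf]
  by_cases h0 : g i % f = 0
  · rw [h0, map_zero, norm_zero, mul_zero]; norm_num
  rw [norm_aeval_eq ht1 h0, inv_mul_le_iff₀ (by positivity), mul_one]
  refine pow_le_pow_right₀ ht1.le (natDegree_le_natDegree ?_)
  exact (EuclideanDomain.mod_lt (g i) hf).le

/-- The residues at `∞` have bounded degree over `Fr`: a linear relation over `Fr[t]` between the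
powers of `x` yields a congruence between their leading coefficients. -/
theorem IsAffineRingAway.exists_residue_polynomial (hA : IsAffineRingAway Fr A k inf)
    (hK : IsCompletionAt inf K) : ∃ n : ℕ, ∀ x : K, ‖x‖ ≤ 1 →
      ∃ P : Fr[X], P ≠ 0 ∧ P.natDegree ≤ n ∧ ‖aeval x P‖ < 1 := by
  have := hK.ultrametric
  obtain ⟨t, ht, ht1⟩ := hK.exists_one_lt_norm hA
  set τ : K := algebraMap k K (algebraMap A k t) with hτ
  have hmap : ∀ f : Fr[X], algebraMap k K (algebraMap A k (aeval t f)) = aeval τ f := fun f => by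
    rw [← aeval_algebraMap_apply, hτ, ← aeval_algebraMap_apply]
  obtain ⟨n, hn⟩ : ∃ n : ℕ, ∀ v : Fin (n + 1) → A, ∃ g : Fin (n + 1) → Fr[X],
      g ≠ 0 ∧ ∑ i, aeval t (g i) * v i = 0 := by
    let _ := polyAlgebra Fr t
    have hfin : Module.Finite Fr[X] A := hA.finite_polyAlgebra ht
    obtain ⟨s, hs⟩ := hfin.fg_top
    refine ⟨s.card, fun v => ?_⟩
    have hdep : ¬ LinearIndependent Fr[X] v := fun h => by
      have h1 := linearIndependent_le_span_finset v h s hs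
      simp only [Cardinal.mk_fintype, Fintype.card_fin, Nat.cast_le] at h1
      omega
    rw [Fintype.not_linearIndependent_iff] at hdep
    obtain ⟨g, hg, i, hi⟩ := hdep
    exact ⟨g, fun h => hi (congrFun h i), hg⟩
  refine ⟨n, fun z hz => ?_⟩
  obtain ⟨x, hx⟩ := hK.exists_norm_sub_lt z one_pos
  have hx1 : ‖algebraMap k K x‖ ≤ 1 := by
    have h := IsUltrametricDist.norm_add_le_max z (-(z - algebraMap k K x))
    rw [norm_neg, ← sub_eq_add_neg, sub_sub_cancel] at h
    exact h.trans (max_le hz hx.le)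
  obtain ⟨b, f, hf, hb⟩ := hA.exists_eq_div ht x
  obtain ⟨g, hg0, hg⟩ := hn fun i => b ^ (i : ℕ) * aeval t f ^ (n - i)
  have hfτ : aeval τ f ≠ 0 := norm_pos_iff.mp (by
    rw [norm_aeval_eq ht1 hf]; exact pow_pos (zero_lt_one.trans ht1) _)
  have hrel : ∑ i, aeval τ (g i) * algebraMap k K x ^ (i : ℕ) = 0 := by
    have h1 := congrArg (fun a => algebraMap k K (algebraMap A k a)) hg
    simp only [map_sum, map_mul, map_pow, map_zero, hmap, ← hb] at h1
    have h2 : ∀ i : Fin (n + 1), aeval τ (g i) * ((algebraMap k K x * aeval τ f) ^ (i : ℕ) *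
        aeval τ f ^ (n - i)) = aeval τ f ^ n * (aeval τ (g i) * algebraMap k K x ^ (i : ℕ)) :=
      fun i => by
        have h3 : aeval τ f ^ n = aeval τ f ^ (i : ℕ) * aeval τ f ^ (n - i) := by
          rw [← pow_add, Nat.add_sub_cancel' (Nat.lt_succ_iff.mp i.2)]
        rw [h3, mul_pow]; ring
    simp only [h2, ← Finset.mul_sum] at h1
    exact (mul_eq_zero.mp h1).resolve_left (pow_ne_zero _ hfτ)
  -- `d` is the largest degree of a coefficient of the relation
  set d := Finset.univ.sup fun i => (g i).natDegree with hd
  have hdeg : ∀ i, (g i).natDegree ≤ d := fun i =>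
    Finset.le_sup (f := fun i => (g i).natDegree) (Finset.mem_univ i)
  obtain ⟨i₀, hi₀⟩ : ∃ i, (g i).coeff d ≠ 0 := by
    obtain ⟨i, -, hi⟩ := Finset.exists_mem_eq_sup Finset.univ Finset.univ_nonempty
      (fun i => (g i).natDegree)
    by_cases h0 : g i = 0
    · obtain ⟨j, hj⟩ := Function.ne_iff.mp hg0
      have : d = 0 := by rw [hd, hi, h0, natDegree_zero]
      refine ⟨j, fun h => hj ?_⟩
      rw [eq_C_of_natDegree_le_zero ((hdeg j).trans this.le), ← this, h, C_0]
      rfl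
    · refine ⟨i, ?_⟩
      rw [hd, hi]
      simpa using h0
  let P : Fr[X] := ∑ i : Fin (n + 1), monomial (i : ℕ) ((g i).coeff d)
  have hPcoeff : ∀ i : Fin (n + 1), P.coeff i = (g i).coeff d := fun i => by
    simp only [P, finsetSum_coeff, coeff_monomial]
    rw [Finset.sum_eq_single i]
    · simp
    · intro j _ hj
      rw [if_neg fun h => hj (Fin.ext h)]
    · simp
  refine ⟨P, fun h => hi₀ (by rw [← hPcoeff, h, coeff_zero]), ?_, ?_⟩
  · refine natDegree_sum_le_of_forall_le _ _ fun i _ => (natDegree_monomial_le _).trans ?_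
    omega
  have hsmall : ‖aeval (algebraMap k K x) P‖ < 1 := by
    have hτd : (0 : ℝ) < ‖τ‖ ^ d := pow_pos (zero_lt_one.trans ht1) _
    have h1 : aeval (algebraMap k K x) P * τ ^ d =
        -∑ i : Fin (n + 1), (aeval τ (g i) - algebraMap Fr K ((g i).coeff d) * τ ^ d) *
          algebraMap k K x ^ (i : ℕ) := by
      simp only [sub_mul, Finset.sum_sub_distrib, hrel, zero_sub, neg_neg]
      simp only [P, map_sum, aeval_monomial, Finset.sum_mul]
      refine Finset.sum_congr rfl fun i _ => by ring
    have h2 : ‖aeval (algebraMap k K x) P * τ ^ d‖ < ‖τ‖ ^ d := by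
      rw [h1, norm_neg]
      refine norm_sum_lt hτd fun i _ => ?_
      rw [norm_mul, norm_pow]
      exact (mul_le_of_le_one_right (norm_nonneg _)
        (pow_le_one₀ (norm_nonneg _) hx1)).trans_lt (norm_aeval_sub_leading_lt ht1 (hdeg i))
    rw [norm_mul, norm_pow] at h2
    exact (mul_lt_iff_lt_one_left hτd).mp h2
  have h := IsUltrametricDist.norm_add_le_max (aeval z P - aeval (algebraMap k K x) P)
    (aeval (algebraMap k K x) P)
  rw [sub_add_cancel] at h
  exact h.trans_lt (max_lt ((norm_aeval_sub_aeval_le hz hx1 P).trans_lt hx) hsmall)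

end Infinity

section Residues

variable {Fr A k K C : Type*} [Field Fr] [Finite Fr] [CommRing A] [IsDedekindDomain A] [Field k]
  [Algebra Fr A] [Algebra A k] [Algebra Fr k] [IsScalarTower Fr A k] [IsFractionRing A k]
  {inf : ValuationSubring k} [NontriviallyNormedField K] [Algebra k K] [Algebra Fr K]
  [IsScalarTower Fr k K] [NormedField C] [NormedAlgebra K C]

/-- Every integral element of `K` is congruent to a constant. -/
def HasConstantResidues (Fr K : Type*) [Field Fr] [NontriviallyNormedField K] [Algebra Fr K] :
    Prop :=
  ∀ x : K, ‖x‖ ≤ 1 → ∃ ω : algebraicClosure Fr K, ‖x - ω‖ < 1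

theorem isAlgebraic_const (ω : algebraicClosure Fr K) : IsAlgebraic Fr (ω : K) :=
  mem_algebraicClosure_iff.mp ω.2

theorem norm_const_eq_one {ω : algebraicClosure Fr K} (h : ω ≠ 0) : ‖(ω : K)‖ = 1 :=
  norm_eq_one_of_isAlgebraic (isAlgebraic_const ω) (by exact_mod_cast h)

theorem norm_constField_le_one (ω : algebraicClosure Fr K) : ‖(ω : K)‖ ≤ 1 := by
  by_cases h : ω = 0
  · simp [h]
  · exact (norm_const_eq_one h).le

/-- The field of constants of `K` is finite: its elements are roots of polynomials over `Fr` of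
bounded degree. -/
theorem finite_constants (hA : IsAffineRingAway Fr A k inf) (hK : IsCompletionAt inf K) :
    Finite (algebraicClosure Fr K) := by
  obtain ⟨n, hn⟩ := hA.exists_residue_polynomial hK
  have hfin : Finite (degreeLT Fr (n + 1)) :=
    Finite.of_equiv _ (degreeLTEquiv Fr (n + 1)).toEquiv.symm
  have h1 : (⋃ P : degreeLT Fr (n + 1), (P : Fr[X]).rootSet K).Finite :=
    Set.finite_iUnion fun P => rootSet_finite _ _
  refine (h1.subset ?_ : ((algebraicClosure Fr K : IntermediateField Fr K) : Set K).Finite)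
  intro ω hω
  obtain ⟨P, hP, hdeg, hlt⟩ := hn ω (norm_constField_le_one ⟨ω, hω⟩)
  refine Set.mem_iUnion.mpr ⟨⟨P, mem_degreeLT.mpr ?_⟩, ?_⟩
  · exact degree_le_natDegree.trans_lt (by exact_mod_cast Nat.lt_succ_of_le hdeg)
  · rw [mem_rootSet]
    refine ⟨hP, ?_⟩
    by_contra h0
    have halg : IsAlgebraic Fr (aeval ω P) :=
      aeval_algebraMap_apply K (⟨ω, hω⟩ : algebraicClosure Fr K) P ▸ isAlgebraic_const _
    exact hlt.ne (norm_eq_one_of_isAlgebraic halg h0)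

theorem isClosed_range_algebraMap [CompleteSpace K] :
    IsClosed (Set.range (algebraMap K C)) :=
  (algebraMap_isometry K C).isClosedEmbedding.isClosed_range

/-- A residue is a root modulo the maximal ideal of a polynomial over `Fr`, so of a polynomial with
a root in `C` congruent to it; this root of unity lies in the complete field `K`. -/
theorem hasConstantResidues (p : ℕ) [Fact p.Prime] [CharP C p]
    (hA : IsAffineRingAway Fr A k inf) (hK : IsCompletionAt inf K)
    (hC : IsCompletedAlgClosure K C) : HasConstantResidues Fr K := by
  intro x hx
  have := hK.complete
  have := hC.algClosed
  obtain ⟨n, hn⟩ := hA.exists_residue_polynomial hK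
  obtain ⟨P, hP, -, hlt⟩ := hn x hx
  set f : Fr →+* C := (algebraMap K C).comp (algebraMap Fr K) with hf
  set Q : Fr[X] := P * Polynomial.C P.leadingCoeff⁻¹ with hQ
  have hQm : Q.Monic := monic_mul_leadingCoeff_inv hP
  have hQx : ‖aeval x Q‖ < 1 := by
    rw [hQ, map_mul, aeval_C, norm_mul, norm_const_of_ne_zero (by simpa using hP), mul_one]
    exact hlt
  obtain ⟨w, hw, hxw⟩ := exists_root_norm_sub_lt (hQm.map f) (x := algebraMap K C x) (by
    rw [eval_map, hf, ← hom_eval₂, norm_algebraMap']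
    exact hQx)
  by_cases hw0 : w = 0
  · refine ⟨0, ?_⟩
    rw [hw0, sub_zero, norm_algebraMap'] at hxw
    simpa using hxw
  have hroot : Q.eval₂ f w = 0 := by rw [← eval_map]; exact hw
  obtain ⟨m, hm, hwm⟩ := exists_pow_eq_one_of_root f hQm.ne_zero hroot hw0
  obtain ⟨ω, hω⟩ : w ∈ Set.range (algebraMap K C) :=
    rootOfUnity_mem p isClosed_range_algebraMap
      (by rintro _ ⟨y, rfl⟩ n; exact ⟨y ^ n, map_pow _ _ _⟩) ⟨x, rfl⟩ hxw hm hwm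
  refine ⟨⟨ω, mem_algebraicClosure_iff.mpr ⟨Q, hQm.ne_zero, ?_⟩⟩, ?_⟩
  · apply (algebraMap K C).injective
    rw [map_zero, ← hroot, ← hω, hf, ← hom_eval₂]
    rfl
  · rw [← hω, ← map_sub, norm_algebraMap'] at hxw
    exact hxw

end Residues

section Sign

variable {Fr K : Type*} [Field Fr] [NontriviallyNormedField K] [Algebra Fr K]

namespace SignData

theorem norm_π_pos (S : SignData Fr K) : 0 < ‖(S.π : K)‖ := norm_pos_iff.mpr S.π.ne_zero

/-- The absolute values of `K` are the integral powers of `‖π‖`. -/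
theorem exists_norm_eq_zpow (S : SignData Fr K) (z : Kˣ) :
    ∃ n : ℤ, ‖(z : K)‖ = ‖(S.π : K)‖ ^ n := by
  have hpos := S.norm_π_pos
  obtain ⟨n, hn1, hn2⟩ := exists_mem_Ioc_zpow (x := ‖(z : K)‖) (y := ‖(S.π : K)‖⁻¹)
    (norm_pos_iff.mpr z.ne_zero) ((one_lt_inv₀ hpos).mpr S.norm_π_lt_one)
  rw [inv_zpow, inv_lt_iff_one_lt_mul₀ (zpow_pos hpos n)] at hn1
  rw [inv_zpow, le_inv_comm₀ (norm_pos_iff.mpr z.ne_zero) (zpow_pos hpos _),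
    ← one_div, le_div_iff₀ (norm_pos_iff.mpr z.ne_zero)] at hn2
  have hw : ‖((z * S.π ^ (n + 1) : Kˣ) : K)‖ = ‖(S.π : K)‖ ^ (n + 1) * ‖(z : K)‖ := by
    push_cast
    rw [norm_mul, norm_zpow, mul_comm]
  refine ⟨-(n + 1), ?_⟩
  rw [zpow_neg]
  refine eq_inv_of_mul_eq_one_right (le_antisymm hn2 (not_lt.mp fun hlt => ?_))
  have h2 := S.norm_le_norm_π _ (hw ▸ hlt)
  rw [hw, zpow_add_one₀ hpos.ne', mul_right_comm, mul_le_iff_le_one_left hpos] at h2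
  rw [mul_comm] at hn1
  exact absurd h2 (not_le.mpr (by linarith))

theorem norm_eq_zpow_ord (S : SignData Fr K) (z : Kˣ) : ‖(z : K)‖ = ‖(S.π : K)‖ ^ S.ord z :=
  Classical.epsilon_spec (S.exists_norm_eq_zpow z)

theorem ord_eq_of_norm_eq (S : SignData Fr K) {z : Kˣ} {n : ℤ} (h : ‖(z : K)‖ = ‖(S.π : K)‖ ^ n) :
    S.ord z = n :=
  zpow_right_injective₀ S.norm_π_pos S.norm_π_lt_one.ne (by
    change ‖(S.π : K)‖ ^ S.ord z = ‖(S.π : K)‖ ^ n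
    rw [← h, ← S.norm_eq_zpow_ord])

theorem ord_mul (S : SignData Fr K) (z w : Kˣ) : S.ord (z * w) = S.ord z + S.ord w :=
  S.ord_eq_of_norm_eq (by
    push_cast
    rw [norm_mul, S.norm_eq_zpow_ord z, S.norm_eq_zpow_ord w, zpow_add₀ S.norm_π_pos.ne'])

theorem angle_mul (S : SignData Fr K) (z w : Kˣ) : S.angle (z * w) = S.angle z * S.angle w := by
  rw [angle, angle, angle, ord_mul, neg_add, zpow_add]
  exact mul_mul_mul_comm _ _ _ _

/-- The map `z ↦ ⟨z⟩` as a homomorphism. -/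
def angleHom (S : SignData Fr K) : Kˣ →* Kˣ := MonoidHom.mk' S.angle S.angle_mul

theorem angle_pow (S : SignData Fr K) (z : Kˣ) (n : ℕ) : S.angle (z ^ n) = S.angle z ^ n :=
  map_pow S.angleHom z n

theorem norm_angle (S : SignData Fr K) (z : Kˣ) : ‖(S.angle z : K)‖ = 1 := by
  rw [angle]
  push_cast
  rw [norm_mul, norm_zpow, S.norm_eq_zpow_ord z, ← zpow_add₀ S.norm_π_pos.ne', neg_add_cancel,
    zpow_zero]

theorem sgn_angle (S : SignData Fr K) (z : Kˣ) : S.sgn (S.angle z) = S.sgn z := by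
  rw [angle, map_mul, map_zpow, S.sgn_π, one_zpow, one_mul]

/-- The sign of a one-unit is trivial, since it is a `(q - 1)`-th power, for `q` the number of
constants. -/
theorem sgn_oneUnit (p : ℕ) [Fact p.Prime] [CharP Fr p] [CompleteSpace K]
    [IsUltrametricDist K] [Finite (algebraicClosure Fr K)] (S : SignData Fr K) {u : Kˣ}
    (hu : ‖(u : K) - 1‖ < 1) : S.sgn u = 1 := by
  have : CharP K p := charP_of_injective_algebraMap (algebraMap Fr K).injective p
  have : CharP (algebraicClosure Fr K) p :=
    charP_of_injective_algebraMap (algebraMap Fr (algebraicClosure Fr K)).injective p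
  have : Fintype (algebraicClosure Fr K) := Fintype.ofFinite _
  obtain ⟨f, -, hf⟩ := FiniteField.card (algebraicClosure Fr K) p
  obtain ⟨w, hw⟩ := exists_pow_eq_of_oneUnit p hu f.ne_zero
  have hq1 : p ^ (f : ℕ) - 1 ≠ 0 := by
    rw [← hf]
    have := Fintype.one_lt_card (α := algebraicClosure Fr K)
    omega
  have hw0 : w ≠ 0 := fun h => u.ne_zero (by rw [← hw, h, zero_pow hq1])
  have hu' : u = Units.mk0 w hw0 ^ (p ^ (f : ℕ) - 1) := Units.ext (by simp [hw])
  rw [hu', map_pow, ← hf]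
  exact Units.ext (by
    push_cast
    exact FiniteField.pow_card_sub_one_eq_one _ (Units.ne_zero _))

/-- The sign of an element of absolute value `1` is its residue, so the positive ones are
one-units. -/
theorem norm_sub_one_lt_of_sgn_eq_one (p : ℕ) [Fact p.Prime] [CharP Fr p] [CompleteSpace K]
    [IsUltrametricDist K] [Finite Fr] [Finite (algebraicClosure Fr K)]
    (hres : HasConstantResidues Fr K)
    (S : SignData Fr K) {z : Kˣ} (hz : ‖(z : K)‖ = 1) (hs : S.sgn z = 1) :
    ‖(z : K) - 1‖ < 1 := by
  obtain ⟨ω, hω⟩ := hres z hz.le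
  have hω0 : ω ≠ 0 := fun h => by simp [h, hz] at hω
  let c : Kˣ := Units.map (algebraMap (algebraicClosure Fr K) K : _ →* K) (Units.mk0 ω hω0)
  have hc : (c : K) = ω := rfl
  have h1 : ‖((z * c⁻¹ : Kˣ) : K) - 1‖ < 1 := by
    push_cast
    rw [hc]
    have hωK : (ω : K) ≠ 0 := by exact_mod_cast hω0
    have h2 : (z : K) * (ω : K)⁻¹ - 1 = (z - ω) * (ω : K)⁻¹ := by field_simp
    rw [h2, norm_mul, norm_inv, norm_const_eq_one hω0, inv_one, mul_one]
    exact hω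
  have h2 := S.sgn_oneUnit p h1
  rw [map_mul, hs, one_mul, map_inv, S.sgn_const, inv_eq_one] at h2
  have h3 : ω = 1 := congrArg Units.val h2
  rw [h3] at hω
  simpa using hω

end SignData

end Sign

section ClassNumber

variable {Fr A k K : Type*} [Field Fr] [Finite Fr] [CommRing A] [IsDedekindDomain A] [Field k]
  [Algebra Fr A] [Algebra A k] [Algebra Fr k] [IsScalarTower Fr A k] [IsFractionRing A k]
  {inf : ValuationSubring k} [NontriviallyNormedField K] [Algebra k K] [Algebra Fr K]
  [IsScalarTower Fr k K]

/-- The index is finite because the class group and the group of signs are. -/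
theorem index_posPrincipal_ne_zero (hA : IsAffineRingAway Fr A k inf) (hK : IsCompletionAt inf K)
    (S : SignData Fr K) : (S.posPrincipal A k).index ≠ 0 := by
  have hcl := hA.finite_classGroup
  have := finite_constants hA hK
  rw [SignData.posPrincipal, Subgroup.index_map]
  refine mul_ne_zero ?_ ?_
  · have h1 : (S.sgnOn k).ker.FiniteIndex := inferInstance
    have h2 : ((S.sgnOn k).ker ⊔ (toPrincipalIdeal A k).ker).FiniteIndex :=
      Subgroup.finiteIndex_of_le le_sup_left
    exact h2.index_ne_zero
  · have : Finite ((FractionalIdeal A⁰ k)ˣ ⧸ (toPrincipalIdeal A k).range) :=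
      Finite.of_equiv _ (ClassGroup.equiv k).toEquiv
    exact Subgroup.index_ne_zero_of_finite

end ClassNumber

/-! ### The degree of a principal ideal -/

section ProductFormula

variable {Fr A k K : Type*} [Field Fr] [Finite Fr] [CommRing A] [IsDedekindDomain A] [Field k]
  [Algebra Fr A] [Algebra A k] [Algebra Fr k] [IsScalarTower Fr A k] [IsFractionRing A k]
  {inf : ValuationSubring k} [NontriviallyNormedField K] [Algebra k K] [Algebra Fr K]
  [IsScalarTower Fr k K]

/-- The residue in the field of constants, as a linear map on the integral elements of `K`. -/
theorem exists_residueMap [IsUltrametricDist K]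
    (hres : HasConstantResidues Fr K)
    {M : Type*} [AddCommGroup M] [Module Fr M] (g : M →ₗ[Fr] K) (hg : ∀ x, ‖g x‖ ≤ 1) :
    ∃ r : M →ₗ[Fr] algebraicClosure Fr K, ∀ x, ‖g x - r x‖ < 1 := by
  choose ω hω using fun x => hres (g x) (hg x)
  have huniq : ∀ {z : K} {w w' : algebraicClosure Fr K}, ‖z - w‖ < 1 → ‖z - w'‖ < 1 → w = w' := by
    intro z w w' h h'
    refine Subtype.ext (eq_of_isAlgebraic_of_norm_sub_lt (isAlgebraic_const w)
      (isAlgebraic_const w') ?_)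
    have h1 : (w : K) - w' = (z - w') + -(z - w) := by ring
    rw [h1]
    exact (IsUltrametricDist.norm_add_le_max _ _).trans_lt (max_lt h' (by rwa [norm_neg]))
  refine ⟨⟨⟨ω, fun x y => huniq (hω (x + y)) ?_⟩, fun c x => huniq (hω (c • x)) ?_⟩, hω⟩
  · have h1 : g (x + y) - ((ω x + ω y : algebraicClosure Fr K) : K) =
        (g x - ω x) + (g y - ω y) := by push_cast; rw [map_add]; ring
    rw [h1]
    exact (IsUltrametricDist.norm_add_le_max _ _).trans_lt (max_lt (hω x) (hω y))
  · have h1 : g (c • x) - ((c • ω x : algebraicClosure Fr K) : K) =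
        algebraMap Fr K c * (g x - ω x) := by
      rw [map_smul, IntermediateField.coe_smul, ← smul_sub, Algebra.smul_def]
    simp only [RingHom.id_apply, h1]
    rw [norm_mul]
    exact (mul_le_of_le_one_left (norm_nonneg _) (norm_const_le_one c)).trans_lt (hω x)

/-- The absolute value at `∞` of an element of `A`. -/
def normInf (K : Type*) {A : Type*} (k : Type*) [CommRing A] [Field k] [Algebra A k]
    [NontriviallyNormedField K] [Algebra k K] (a : A) : ℝ := ‖algebraMap k K (algebraMap A k a)‖

theorem algebraMap_algebraMap_const {Fr A k K : Type*} [CommRing Fr] [CommRing A] [Field k]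
    [Field K] [Algebra Fr A] [Algebra A k] [Algebra Fr k] [IsScalarTower Fr A k] [Algebra k K]
    [Algebra Fr K] [IsScalarTower Fr k K] (c : Fr) :
    algebraMap k K (algebraMap A k (algebraMap Fr A c)) = algebraMap Fr K c := by
  rw [← IsScalarTower.algebraMap_apply Fr A k, ← IsScalarTower.algebraMap_apply Fr k K]

/-- The space of functions in `A` with a pole of order at most `m` at `∞`. -/
def boundedPole (Fr A k : Type*) {K : Type*} [Field Fr] [Finite Fr] [CommRing A] [Field k]
    [Algebra Fr A] [Algebra A k] [Algebra Fr k] [IsScalarTower Fr A k] [NontriviallyNormedField K]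
    [Algebra k K] [Algebra Fr K] [IsScalarTower Fr k K] [IsUltrametricDist K]
    (S : SignData Fr K) (m : ℕ) : Submodule Fr A where
  carrier := {a | normInf K k a ≤ ‖(S.π : K)‖⁻¹ ^ m}
  add_mem' {a b} ha hb := by
    simp only [Set.mem_ofPred_eq, normInf, map_add] at *
    exact (IsUltrametricDist.norm_add_le_max _ _).trans (max_le ha hb)
  zero_mem' := by
    simp only [Set.mem_ofPred_eq, normInf, map_zero, norm_zero]; positivity
  smul_mem' c a ha := by
    simp only [Set.mem_ofPred_eq, normInf] at *
    rw [Algebra.smul_def, map_mul, map_mul, norm_mul, algebraMap_algebraMap_const]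
    exact (mul_le_of_le_one_left (norm_nonneg _) (norm_const_le_one c)).trans ha

theorem mem_boundedPole [IsUltrametricDist K] {S : SignData Fr K} {m : ℕ} {a : A} :
    a ∈ boundedPole Fr A k S m ↔ normInf K k a ≤ ‖(S.π : K)‖⁻¹ ^ m := Iff.rfl

theorem SignData.one_lt_inv (S : SignData Fr K) : 1 < ‖(S.π : K)‖⁻¹ :=
  (one_lt_inv₀ S.norm_π_pos).mpr S.norm_π_lt_one

/-- Increasing the allowed order of the pole by one eventually increases the dimension by the
degree of `∞`: leading coefficients at `∞` embed the successive quotients into the field of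
constants, and by approximation every constant is a leading coefficient. -/
theorem finrank_boundedPole (hA : IsAffineRingAway Fr A k inf) (hK : IsCompletionAt inf K)
    (hres : HasConstantResidues Fr K) [IsUltrametricDist K]
    (S : SignData Fr K) :
    (∀ m, Module.Finite Fr (boundedPole Fr A k S m)) ∧ ∃ m₀, ∀ m, m₀ ≤ m →
      Module.finrank Fr (boundedPole Fr A k S (m + 1)) =
        Module.finrank Fr (boundedPole Fr A k S m) + degInf Fr K := by
  have hfinC := finite_constants hA hK
  have hρ := S.norm_π_pos
  -- the leading coefficient at `∞`
  have hlead : ∀ m, ∃ r : boundedPole Fr A k S (m + 1) →ₗ[Fr] algebraicClosure Fr K,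
      ∀ x : boundedPole Fr A k S (m + 1),
        ‖algebraMap k K (algebraMap A k (x : A)) * (S.π : K) ^ (m + 1) - r x‖ < 1 := by
    intro m
    let g : A →ₗ[Fr] K := (IsScalarTower.toAlgHom Fr k K).toLinearMap.comp
      (IsScalarTower.toAlgHom Fr A k).toLinearMap
    refine exists_residueMap hres ((LinearMap.mulRight Fr ((S.π : K) ^ (m + 1))).comp
      (g.comp (boundedPole Fr A k S (m + 1)).subtype)) fun x => ?_
    have h1 := mem_boundedPole.mp x.2
    change ‖algebraMap k K (algebraMap A k x) * (S.π : K) ^ (m + 1)‖ ≤ 1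
    rw [norm_mul, norm_pow]
    rw [inv_pow, ← one_div, le_div_iff₀ (by positivity)] at h1
    exact h1
  choose r hr using hlead
  have hker : ∀ m, (LinearMap.ker (r m)).map (boundedPole Fr A k S (m + 1)).subtype =
      boundedPole Fr A k S m := by
    intro m
    have hiff : ∀ x : boundedPole Fr A k S (m + 1),
        r m x = 0 ↔ (x : A) ∈ boundedPole Fr A k S m := by
      intro x
      have h1 := hr m x
      have hiff1 : r m x = 0 ↔ ‖algebraMap k K (algebraMap A k x) * (S.π : K) ^ (m + 1)‖ < 1 := by
        constructor
        · intro h; rw [h] at h1; simpa using h1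
        · intro h
          by_contra hne
          have h2 := IsUltrametricDist.norm_add_le_max
            (algebraMap k K (algebraMap A k x) * (S.π : K) ^ (m + 1))
            (-(algebraMap k K (algebraMap A k x) * (S.π : K) ^ (m + 1) - r m x))
          rw [norm_neg, ← sub_eq_add_neg, sub_sub_cancel, norm_const_eq_one hne] at h2
          exact absurd h2 (not_le.mpr (max_lt h h1))
      rw [hiff1, mem_boundedPole, normInf]
      constructor
      · intro h
        have h2 := S.norm_le_norm_π _ h
        rw [norm_mul, norm_pow, pow_succ, ← mul_assoc, mul_le_iff_le_one_left hρ,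
          ← le_div_iff₀ (by positivity), one_div, ← inv_pow] at h2
        exact h2
      · intro h
        rw [inv_pow, ← one_div, le_div_iff₀ (by positivity)] at h
        rw [norm_mul, norm_pow, pow_succ, ← mul_assoc]
        exact (mul_le_of_le_one_left hρ.le h).trans_lt S.norm_π_lt_one
    ext a
    constructor
    · rintro ⟨x, hx, rfl⟩
      exact (hiff x).mp hx
    · intro ha
      have ha' : a ∈ boundedPole Fr A k S (m + 1) := by
        rw [mem_boundedPole] at ha ⊢
        exact ha.trans (pow_le_pow_right₀ S.one_lt_inv.le m.le_succ)
      exact ⟨⟨a, ha'⟩, (hiff ⟨a, ha'⟩).mpr ha, rfl⟩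
  have hequiv : ∀ m, Nonempty (LinearMap.ker (r m) ≃ₗ[Fr] boundedPole Fr A k S m) := fun m =>
    ⟨(Submodule.equivMapOfInjective _ (Submodule.injective_subtype _) _).trans
      (LinearEquiv.ofEq _ _ (hker m))⟩
  have hfin : ∀ m, Module.Finite Fr (boundedPole Fr A k S m) := by
    intro m
    induction m with
    | zero =>
      let f : Fr →ₗ[Fr] A := Algebra.linearMap Fr A
      refine Module.Finite.of_surjective (f.codRestrict (boundedPole Fr A k S 0) fun c => ?_) ?_
      · rw [mem_boundedPole, pow_zero, normInf, Algebra.linearMap_apply,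
          algebraMap_algebraMap_const]
        exact norm_const_le_one c
      · intro a
        have ha := mem_boundedPole.mp a.2
        rw [pow_zero, normInf, hK.norm_le_one_iff] at ha
        obtain ⟨c, hc⟩ := hA.exists_const ha
        exact ⟨c, Subtype.ext hc⟩
    | succ m ih =>
      obtain ⟨e⟩ := hequiv m
      have h1 : Module.Finite Fr (LinearMap.ker (r m)) := Module.Finite.equiv e.symm
      have h2 : Module.Finite Fr (boundedPole Fr A k S (m + 1) ⧸ LinearMap.ker (r m)) :=
        Module.Finite.equiv (r m).quotKerEquivRange.symm
      exact Module.Finite.of_submodule_quotient (LinearMap.ker (r m))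
  refine ⟨hfin, ?_⟩
  obtain ⟨B, hB⟩ := hA.exists_bounded_error hK
  obtain ⟨m₀, hm₀⟩ := pow_unbounded_of_one_lt B S.one_lt_inv
  refine ⟨m₀, fun m hm => ?_⟩
  have hsurj : Function.Surjective (r m) := by
    intro ω
    obtain ⟨z, hz⟩ := hK.exists_norm_sub_lt ((ω : K) * ((S.π : K) ^ (m + 1))⁻¹) one_pos
    obtain ⟨a, ha⟩ := hB z
    set R := ‖(S.π : K)‖⁻¹ ^ (m + 1) with hR
    have hRpos : 0 < R := pow_pos (inv_pos.mpr hρ) _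
    have hBR : B < R := hm₀.trans_le (pow_le_pow_right₀ S.one_lt_inv.le (by omega))
    have h1 : ‖(ω : K) * ((S.π : K) ^ (m + 1))⁻¹ - algebraMap k K (algebraMap A k a)‖ < R := by
      have h2 := IsUltrametricDist.norm_add_le_max
        ((ω : K) * ((S.π : K) ^ (m + 1))⁻¹ - algebraMap k K z)
        (algebraMap k K (z - algebraMap A k a))
      rw [map_sub, sub_add_sub_cancel] at h2
      rw [map_sub] at ha
      refine h2.trans_lt (max_lt (hz.trans ?_) (ha.trans_lt hBR))
      exact one_lt_pow₀ S.one_lt_inv (by omega)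
    have h3 : ‖(ω : K) * ((S.π : K) ^ (m + 1))⁻¹‖ ≤ R := by
      rw [norm_mul, norm_inv, norm_pow, ← inv_pow]
      exact mul_le_of_le_one_left hRpos.le (norm_constField_le_one ω)
    have hmem : a ∈ boundedPole Fr A k S (m + 1) := by
      rw [mem_boundedPole, normInf]
      have h4 := IsUltrametricDist.norm_add_le_max ((ω : K) * ((S.π : K) ^ (m + 1))⁻¹)
        (-((ω : K) * ((S.π : K) ^ (m + 1))⁻¹ - algebraMap k K (algebraMap A k a)))
      rw [norm_neg, ← sub_eq_add_neg, sub_sub_cancel] at h4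
      exact h4.trans (max_le h3 h1.le)
    refine ⟨⟨a, hmem⟩, ?_⟩
    have h5 := hr m ⟨a, hmem⟩
    refine Subtype.ext (eq_of_isAlgebraic_of_norm_sub_lt (isAlgebraic_const _)
      (isAlgebraic_const ω) ?_)
    have hπ : (S.π : K) ^ (m + 1) ≠ 0 := pow_ne_zero _ S.π.ne_zero
    have h6 : ((r m ⟨a, hmem⟩ : algebraicClosure Fr K) : K) - ω =
        -(algebraMap k K (algebraMap A k a) * (S.π : K) ^ (m + 1) - r m ⟨a, hmem⟩) +
        -(((ω : K) * ((S.π : K) ^ (m + 1))⁻¹ - algebraMap k K (algebraMap A k a)) *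
          (S.π : K) ^ (m + 1)) := by
      field_simp
      ring
    rw [h6]
    refine (IsUltrametricDist.norm_add_le_max _ _).trans_lt (max_lt (by rwa [norm_neg]) ?_)
    rw [norm_neg, norm_mul, norm_pow, ← lt_div_iff₀ (pow_pos hρ _), one_div]
    rwa [hR, inv_pow ‖(S.π : K)‖] at h1
  have hrn := (r m).finrank_range_add_finrank_ker
  obtain ⟨e⟩ := hequiv m
  rw [LinearMap.range_eq_top.mpr hsurj, finrank_top, e.finrank_eq] at hrn
  rw [degInf]
  omega

/-- The product formula: the degree of a principal ideal is determined by the absolute value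
at `∞` of its generator.  Multiplication by `a` shifts the order of the pole by `v`, so that the
functions with a pole of large order at most `m + v` have an image of dimension `v * d_∞`
in `A / a`; being independent of `m`, this image is everything. -/
theorem finrank_quotient_span (hA : IsAffineRingAway Fr A k inf) (hK : IsCompletionAt inf K)
    (hres : HasConstantResidues Fr K)
    (S : SignData Fr K) {a : A} {v : ℕ} (ha : normInf K k a = ‖(S.π : K)‖⁻¹ ^ v) :
    Module.Finite Fr (A ⧸ Ideal.span {a}) ∧
      Module.finrank Fr (A ⧸ Ideal.span {a}) = v * degInf Fr K := by
  have := hK.ultrametric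
  have hRpos : 0 < ‖(S.π : K)‖⁻¹ := inv_pos.mpr S.norm_π_pos
  obtain ⟨hfin, m₀, hm₀⟩ := finrank_boundedPole hA hK hres S
  have ha0 : a ≠ 0 := by
    rintro rfl
    rw [normInf, map_zero, map_zero, norm_zero] at ha
    exact (pow_pos hRpos v).ne ha
  have hdim : ∀ m, m₀ ≤ m → ∀ v, Module.finrank Fr (boundedPole Fr A k S (m + v)) =
      Module.finrank Fr (boundedPole Fr A k S m) + v * degInf Fr K := by
    intro m hm v
    induction v with
    | zero => simp
    | succ v ih => rw [← add_assoc, hm₀ _ (by omega), ih, Nat.succ_mul, add_assoc]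
  let q : A →ₗ[Fr] A ⧸ Ideal.span {a} := (Ideal.Quotient.mkₐ Fr (Ideal.span {a})).toLinearMap
  let μ : A →ₗ[Fr] A := LinearMap.mulLeft Fr a
  have hμ : Function.Injective μ := fun x y h => mul_left_cancel₀ ha0 h
  let W : ℕ → Submodule Fr (A ⧸ Ideal.span {a}) := fun m => (boundedPole Fr A k S (m + v)).map q
  have hker : ∀ m, (LinearMap.ker (q.domRestrict (boundedPole Fr A k S (m + v)))).map
      (boundedPole Fr A k S (m + v)).subtype = (boundedPole Fr A k S m).map μ := by
    intro m
    ext x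
    have hmul : ∀ y, normInf K k (a * y) ≤ ‖(S.π : K)‖⁻¹ ^ (m + v) ↔
        normInf K k y ≤ ‖(S.π : K)‖⁻¹ ^ m := fun y => by
      have : normInf K k (a * y) = normInf K k y * ‖(S.π : K)‖⁻¹ ^ v := by
        rw [← ha, mul_comm]; simp [normInf]
      rw [this, pow_add, mul_le_mul_iff_left₀ (pow_pos hRpos v)]
    constructor
    · rintro ⟨⟨x, hx⟩, hx0, rfl⟩
      obtain ⟨y, rfl⟩ := Ideal.mem_span_singleton'.mp (Ideal.Quotient.eq_zero_iff_mem.mp hx0)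
      refine ⟨y, ?_, mul_comm a y⟩
      rw [mul_comm] at hx
      exact (hmul y).mp hx
    · rintro ⟨y, hy, rfl⟩
      exact ⟨⟨a * y, (hmul y).mpr hy⟩, Ideal.Quotient.eq_zero_iff_mem.mpr
        (Ideal.mem_span_singleton'.mpr ⟨y, mul_comm y a⟩), rfl⟩
  have hW : ∀ m, m₀ ≤ m → Module.finrank Fr (W m) = v * degInf Fr K := by
    intro m hm
    have h1 := (q.domRestrict (boundedPole Fr A k S (m + v))).finrank_range_add_finrank_ker
    have h2 : Module.finrank Fr (LinearMap.ker (q.domRestrict (boundedPole Fr A k S (m + v)))) =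
        Module.finrank Fr (boundedPole Fr A k S m) := by
      rw [← Submodule.finrank_map_subtype_eq, hker]
      exact (Submodule.equivMapOfInjective μ hμ _).finrank_eq.symm
    rw [h2, hdim m hm v, LinearMap.range_domRestrict] at h1
    change Module.finrank Fr ((boundedPole Fr A k S (m + v)).map q) = _
    omega
  have hWfin : ∀ m, Module.Finite Fr (W m) := fun m => inferInstance
  have hmono : ∀ m, m₀ ≤ m → W m₀ = W m := fun m hm =>
    Submodule.eq_of_le_of_finrank_eq (Submodule.map_mono fun x hx => by
      rw [mem_boundedPole] at hx ⊢
      exact hx.trans (pow_le_pow_right₀ S.one_lt_inv.le (by omega))) (by rw [hW _ le_rfl, hW m hm])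
  have htop : W m₀ = ⊤ := by
    rw [eq_top_iff]
    rintro x -
    obtain ⟨y, rfl⟩ := Ideal.Quotient.mk_surjective x
    obtain ⟨m, hm⟩ := pow_unbounded_of_one_lt (normInf K k y) S.one_lt_inv
    rw [hmono (max m m₀) (le_max_right _ _)]
    refine ⟨y, ?_, rfl⟩
    exact hm.le.trans (pow_le_pow_right₀ S.one_lt_inv.le (by omega))
  constructor
  · have := hWfin m₀
    rw [htop] at this
    exact Module.Finite.equiv Submodule.topEquiv
  · rw [← hW m₀ le_rfl, htop, finrank_top]

end ProductFormula

/-! ### Degrees of ideals -/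

section Degree

variable {Fr A k K : Type*} [Field Fr] [Finite Fr] [CommRing A] [IsDedekindDomain A] [Field k]
  [Algebra Fr A] [Algebra A k] [Algebra Fr k] [IsScalarTower Fr A k] [IsFractionRing A k]
  {inf : ValuationSubring k} [NontriviallyNormedField K] [Algebra k K] [Algebra Fr K]
  [IsScalarTower Fr k K]

/-- In a Dedekind domain `I / IJ` is isomorphic to `A / J`, so dimensions of quotients add up. -/
theorem finrank_quotient_mul {F A : Type*} [Field F] [CommRing A] [IsDedekindDomain A]
    [Algebra F A] {I J : Ideal A} (hI : I ≠ ⊥) (hJ : J ≠ ⊥) [Module.Finite F (A ⧸ (I * J))] :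
    Module.finrank F (A ⧸ (I * J)) = Module.finrank F (A ⧸ I) + Module.finrank F (A ⧸ J) := by
  have hIJ : I * J ≠ ⊥ := mul_ne_zero hI hJ
  obtain ⟨x, hx⟩ := IsDedekindDomain.exists_sup_span_eq (I := I * J) (J := I) Ideal.mul_le_left hIJ
  have hxI : x ∈ I := hx ▸ Ideal.mem_sup_right (Ideal.mem_span_singleton_self x)
  let φ : (A ⧸ (I * J)) →ₗ[F] A ⧸ I := (Ideal.Quotient.factorₐ F Ideal.mul_le_left).toLinearMap
  have hφ : Function.Surjective φ := Ideal.Quotient.factor_surjective Ideal.mul_le_left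
  let ψ : A →ₗ[F] A ⧸ (I * J) :=
    (Ideal.Quotient.mkₐ F (I * J)).toLinearMap.comp (LinearMap.mulRight F x)
  have hkerψ : LinearMap.ker ψ = J.restrictScalars F := by
    ext r
    rw [LinearMap.mem_ker]
    change Ideal.Quotient.mk (I * J) (r * x) = 0 ↔ r ∈ J
    rw [Ideal.Quotient.eq_zero_iff_mem]
    constructor
    · intro h
      have h1 : I * J ∣ I * Ideal.span {r} := by
        rw [Ideal.dvd_iff_le]
        conv_lhs => rw [← hx]
        rw [Ideal.sup_mul, sup_le_iff]
        refine ⟨Ideal.mul_le_left, ?_⟩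
        rw [Ideal.span_singleton_mul_span_singleton, Ideal.span_singleton_le_iff_mem, mul_comm x]
        exact h
      rw [mul_dvd_mul_iff_left hI, Ideal.dvd_iff_le, Ideal.span_singleton_le_iff_mem] at h1
      exact h1
    · intro h
      rw [mul_comm r]
      exact Ideal.mul_mem_mul hxI h
  have hrange : LinearMap.range ψ = LinearMap.ker φ := by
    ext y
    obtain ⟨y, rfl⟩ := Ideal.Quotient.mk_surjective y
    have hφy : Ideal.Quotient.mk (I * J) y ∈ LinearMap.ker φ ↔ y ∈ I := by
      rw [LinearMap.mem_ker, ← Ideal.Quotient.eq_zero_iff_mem]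
      rfl
    rw [hφy]
    constructor
    · rintro ⟨r, hr⟩
      have h1 : r * x - y ∈ I * J := Ideal.Quotient.eq.mp hr
      have h2 := I.sub_mem (I.mul_mem_left r hxI) (Ideal.mul_le_left h1)
      rwa [sub_sub_cancel] at h2
    · intro hy
      rw [← hx] at hy
      obtain ⟨z, hz, w, hw, rfl⟩ := Submodule.mem_sup.mp hy
      obtain ⟨r, rfl⟩ := Ideal.mem_span_singleton'.mp hw
      exact ⟨r, Ideal.Quotient.eq.mpr (by simpa using hz)⟩
  have h1 := φ.finrank_range_add_finrank_ker
  rw [LinearMap.range_eq_top.mpr hφ, finrank_top] at h1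
  have h2 : Module.finrank F (A ⧸ J) = Module.finrank F (LinearMap.ker φ) := by
    rw [← hrange, ← ψ.quotKerEquivRange.finrank_eq, hkerψ]
    rfl
  rw [h2, h1]

/-- A nonzero element of `A` has a pole of some order `v ≥ 0` at `∞`. -/
theorem exists_normInf_eq_pow (hA : IsAffineRingAway Fr A k inf) (hK : IsCompletionAt inf K)
    (S : SignData Fr K) {a : A} (ha : a ≠ 0) : ∃ v : ℕ, normInf K k a = ‖(S.π : K)‖⁻¹ ^ v := by
  have ha' : algebraMap k K (algebraMap A k a) ≠ 0 := by simpa using ha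
  obtain ⟨n, hn⟩ := S.exists_norm_eq_zpow (Units.mk0 _ ha')
  rw [Units.val_mk0] at hn
  have hn0 : n ≤ 0 := by
    by_contra! h
    have h1 : ‖algebraMap k K (algebraMap A k a)‖ < 1 := by
      rw [hn]; exact zpow_lt_one₀ S.norm_π_pos S.norm_π_lt_one h
    obtain ⟨c, rfl⟩ := hA.exists_const ((hK.norm_le_one_iff _).mp h1.le)
    rw [algebraMap_algebraMap_const] at h1
    exact h1.ne (norm_const_of_ne_zero (by rintro rfl; simp at ha))
  refine ⟨n.natAbs, ?_⟩
  rw [normInf, hn, ← zpow_natCast, inv_zpow', Int.ofNat_natAbs_of_nonpos hn0, neg_neg]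

theorem finite_quotient (hA : IsAffineRingAway Fr A k inf) (hK : IsCompletionAt inf K)
    (hres : HasConstantResidues Fr K)
    (S : SignData Fr K) {I : Ideal A} (hI : I ≠ ⊥) : Module.Finite Fr (A ⧸ I) := by
  obtain ⟨a, haI, ha0⟩ := Submodule.exists_mem_ne_zero_of_ne_bot hI
  obtain ⟨v, hv⟩ := exists_normInf_eq_pow hA hK S ha0
  have := (finrank_quotient_span hA hK hres S hv).1
  have hle : Ideal.span {a} ≤ I := (Ideal.span_singleton_le_iff_mem I).mpr haI
  exact Module.Finite.of_surjective (Ideal.Quotient.factorₐ Fr hle).toLinearMap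
    (Ideal.Quotient.factor_surjective hle)

theorem finrank_quotient_pow (hA : IsAffineRingAway Fr A k inf) (hK : IsCompletionAt inf K)
    (hres : HasConstantResidues Fr K)
    (S : SignData Fr K) {I : Ideal A} (hI : I ≠ ⊥) (e : ℕ) :
    Module.finrank Fr (A ⧸ I ^ e) = e * Module.finrank Fr (A ⧸ I) := by
  induction e with
  | zero =>
    rw [pow_zero, zero_mul, Ideal.one_eq_top]
    have : Subsingleton (A ⧸ (⊤ : Ideal A)) := Ideal.Quotient.subsingleton_iff.mpr rfl
    exact Module.finrank_zero_of_subsingleton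
  | succ e ih =>
    have hIe : I ^ e ≠ ⊥ := pow_ne_zero e hI
    have := finite_quotient hA hK hres S (mul_ne_zero hIe hI)
    rw [pow_succ, finrank_quotient_mul hIe hI, ih, Nat.succ_mul]

end Degree

/-! ### The one-units attached to ideals -/

section Bracket

variable {Fr A k K C : Type*} [Field Fr] [Finite Fr] [CommRing A] [IsDedekindDomain A]
  [Field k] [Algebra Fr A] [Algebra A k] [Algebra Fr k] [IsScalarTower Fr A k]
  [IsFractionRing A k] {inf : ValuationSubring k} [NontriviallyNormedField K] [Algebra k K]
  [Algebra Fr K] [IsScalarTower Fr k K] [NormedField C] [NormedAlgebra K C]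

/-- The image in `Kˣ` of an element of `kˣ`. -/
abbrev toK (K : Type*) {k : Type*} [Field k] [Field K] [Algebra k K] : kˣ →* Kˣ :=
  Units.map (algebraMap k K : k →* K)

theorem norm_angle_sub_one_lt (p : ℕ) [Fact p.Prime] [CharP Fr p]
    (hA : IsAffineRingAway Fr A k inf) (hK : IsCompletionAt inf K)
    (hres : HasConstantResidues Fr K)
    (S : SignData Fr K) {i : kˣ} (hi : S.sgnOn k i = 1) :
    ‖(S.angle (toK K i) : K) - 1‖ < 1 := by
  have := hK.complete
  have := hK.ultrametric
  have := finite_constants hA hK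
  exact S.norm_sub_one_lt_of_sgn_eq_one p hres (S.norm_angle _) ((S.sgn_angle _).trans hi)

/-- `⟨I⟩` has its defining property. A one-unit root exists since the index `e` is nonzero and the
angle of a positive element is a one-unit. -/
theorem bracket_spec (p : ℕ) [Fact p.Prime] [CharP Fr p]
    (hA : IsAffineRingAway Fr A k inf) (hK : IsCompletionAt inf K)
    (hres : HasConstantResidues Fr K)
    (hC : IsCompletedAlgClosure K C) (S : SignData Fr K) (I : (FractionalIdeal A⁰ k)ˣ) :
    ‖S.bracket C I - 1‖ < 1 ∧ ∃ i : kˣ, S.sgnOn k i = 1 ∧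
      toPrincipalIdeal A k i = I ^ (S.posPrincipal A k).index ∧
      S.bracket C I ^ (S.posPrincipal A k).index =
        algebraMap K C (S.angle (toK K i) : Kˣ) := by
  have := hC.algClosed
  refine Classical.epsilon_spec (p := fun u : C => ‖u - 1‖ < 1 ∧ ∃ i : kˣ, S.sgnOn k i = 1 ∧
    toPrincipalIdeal A k i = I ^ (S.posPrincipal A k).index ∧
    u ^ (S.posPrincipal A k).index = algebraMap K C (S.angle (toK K i) : Kˣ)) ?_
  obtain ⟨i, hi, hiI⟩ := Subgroup.pow_index_mem (H := S.posPrincipal A k) I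
  have h1 := norm_angle_sub_one_lt p hA hK hres S hi
  obtain ⟨u, hu, hue⟩ := exists_oneUnit_pow_eq (z := algebraMap K C (S.angle (toK K i) : Kˣ))
    (by rwa [← map_one (algebraMap K C), ← map_sub, norm_algebraMap'])
    (index_posPrincipal_ne_zero hA hK S)
  exact ⟨u, hu, i, hi, hiI, hue⟩

/-- A principal ideal has at most one positive generator: the units of `A` are constants, by the
product formula, and a constant is its own sign. -/
theorem eq_of_toPrincipalIdeal_eq (hA : IsAffineRingAway Fr A k inf) (hK : IsCompletionAt inf K)
    (hres : HasConstantResidues Fr K)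
    (S : SignData Fr K) {i j : kˣ} (hi : S.sgnOn k i = 1) (hj : S.sgnOn k j = 1)
    (h : toPrincipalIdeal A k i = toPrincipalIdeal A k j) : i = j := by
  have := finite_constants hA hK
  rw [← mul_inv_eq_one]
  set ε := i * j⁻¹ with hε
  have hsgn : S.sgnOn k ε = 1 := by rw [hε, map_mul, map_inv, hi, hj, inv_one, mul_one]
  have hprin : toPrincipalIdeal A k ε = 1 := by rw [hε, map_mul, map_inv, h, mul_inv_cancel]
  have hmem : ∀ η : kˣ, toPrincipalIdeal A k η = 1 → ∃ a : A, algebraMap A k a = η := by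
    intro η hη
    rw [toPrincipalIdeal_eq_iff, Units.val_one] at hη
    have h1 : (η : k) ∈ (1 : FractionalIdeal A⁰ k) :=
      hη ▸ FractionalIdeal.mem_spanSingleton_self _ _
    exact (FractionalIdeal.mem_one_iff A⁰).mp h1
  obtain ⟨a, ha⟩ := hmem ε hprin
  obtain ⟨b, hb⟩ := hmem ε⁻¹ (by rw [map_inv, hprin, inv_one])
  have hab : a * b = 1 := IsFractionRing.injective A k (by
    rw [map_mul, ha, hb, map_one]; exact ε.mul_inv)
  have hunit : IsUnit a := IsUnit.of_mul_eq_one b hab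
  obtain ⟨v, hv⟩ := exists_normInf_eq_pow hA hK S hunit.ne_zero
  have hv0 : v = 0 := by
    have h1 := (finrank_quotient_span hA hK hres S hv).2
    rw [Ideal.span_singleton_eq_top.mpr hunit] at h1
    have : Subsingleton (A ⧸ (⊤ : Ideal A)) := Ideal.Quotient.subsingleton_iff.mpr rfl
    rw [Module.finrank_zero_of_subsingleton, eq_comm, mul_eq_zero] at h1
    exact h1.resolve_right (Module.finrank_pos (R := Fr) (M := algebraicClosure Fr K)).ne'
  rw [hv0, pow_zero, normInf] at hv
  obtain ⟨c, rfl⟩ := hA.exists_const ((hK.norm_le_one_iff _).mp hv.le)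
  have hc0 : c ≠ 0 := by rintro rfl; simp at hab
  have hεc : toK K ε = Units.map (algebraMap (algebraicClosure Fr K) K : _ →* K)
      (Units.map (algebraMap Fr (algebraicClosure Fr K)).toMonoidHom (Units.mk0 c hc0)) := by
    refine Units.ext ?_
    change algebraMap k K ε = algebraMap (algebraicClosure Fr K) K (algebraMap Fr _ c)
    rw [← ha, algebraMap_algebraMap_const, ← IsScalarTower.algebraMap_apply]
  have h1 : S.sgnOn k ε = S.sgn (toK K ε) := rfl
  rw [h1, hεc, S.sgn_const] at hsgn
  have hc1 : c = 1 := by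
    have h2 := congrArg Units.val hsgn
    exact (algebraMap Fr (algebraicClosure Fr K)).injective (h2.trans (map_one _).symm)
  exact Units.ext (by rw [← ha, hc1, map_one, map_one]; rfl)

/-- Multiplying an ideal by a positive element `a` multiplies the one-unit by `⟨a⟩`. -/
theorem bracket_mul (p : ℕ) [Fact p.Prime] [CharP Fr p]
    (hA : IsAffineRingAway Fr A k inf) (hK : IsCompletionAt inf K)
    (hres : HasConstantResidues Fr K)
    (hC : IsCompletedAlgClosure K C) (S : SignData Fr K) (J : (FractionalIdeal A⁰ k)ˣ) {a : kˣ}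
    (ha : S.sgnOn k a = 1) :
    S.bracket C (J * toPrincipalIdeal A k a) =
      S.bracket C J * algebraMap K C (S.angle (toK K a) : Kˣ) := by
  have := hC.ultrametric
  have : CharP K p := charP_of_injective_algebraMap (algebraMap Fr K).injective p
  have : CharP C p := charP_of_injective_algebraMap (algebraMap K C).injective p
  obtain ⟨h1, i, hi, hiI, hie⟩ := bracket_spec p hA hK hres hC S (J * toPrincipalIdeal A k a)
  obtain ⟨h2, j, hj, hjJ, hje⟩ := bracket_spec p hA hK hres hC S J
  have h3 := norm_angle_sub_one_lt p hA hK hres S ha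
  refine oneUnit_eq_of_pow_eq p h1 (norm_mul_sub_one_lt h2 (by
    rwa [← map_one (algebraMap K C), ← map_sub, norm_algebraMap']))
    (index_posPrincipal_ne_zero hA hK S) ?_
  have hij : i = j * a ^ (S.posPrincipal A k).index :=
    eq_of_toPrincipalIdeal_eq hA hK hres S hi
      (by rw [map_mul, map_pow, hj, ha, one_pow, one_mul])
      (by rw [hiI, map_mul, map_pow, hjJ, mul_pow])
  rw [hie, mul_pow, hje, ← map_pow, ← map_mul, hij, map_mul, map_pow, S.angle_mul, S.angle_pow]
  rfl

theorem exists_mul_toPrincipalIdeal {S : SignData Fr K} {I J : (FractionalIdeal A⁰ k)ˣ}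
    (h : (QuotientGroup.mk I : (FractionalIdeal A⁰ k)ˣ ⧸ S.posPrincipal A k) =
      QuotientGroup.mk J) :
    ∃ a : kˣ, S.sgnOn k a = 1 ∧ J * toPrincipalIdeal A k a = I := by
  obtain ⟨a, ha, haI⟩ := QuotientGroup.eq.mp h.symm
  exact ⟨a, ha, by rw [haI, mul_inv_cancel_left]⟩

theorem finiteDimensional_of_le {K C : Type*} [Field K] [Field C] [Algebra K C]
    {E F : IntermediateField K C} [FiniteDimensional K F] (h : E ≤ F) : FiniteDimensional K E :=
  FiniteDimensional.of_injective (IntermediateField.inclusion h).toLinearMap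
    (IntermediateField.inclusion h).injective

theorem finiteDimensional_adjoin_bracket (p : ℕ) [Fact p.Prime] [CharP Fr p]
    (hA : IsAffineRingAway Fr A k inf)
    (hK : IsCompletionAt inf K)
    (hres : HasConstantResidues Fr K)
    (hC : IsCompletedAlgClosure K C) (S : SignData Fr K) :
    FiniteDimensional K (IntermediateField.adjoin K
      (Set.range fun I : (FractionalIdeal A⁰ k)ˣ => S.bracket C I)) := by
  have hfin : (S.posPrincipal A k).FiniteIndex := ⟨index_posPrincipal_ne_zero hA hK S⟩
  let G := (FractionalIdeal A⁰ k)ˣ ⧸ S.posPrincipal A k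
  have : Finite G := Subgroup.finite_quotient_of_finiteIndex
  let T : Set C := Set.range fun q : G => S.bracket C q.out
  have : Finite T := Set.finite_range _
  have hT : FiniteDimensional K (IntermediateField.adjoin K T) := by
    refine IntermediateField.finiteDimensional_adjoin ?_
    rintro _ ⟨q, rfl⟩
    obtain ⟨-, i, -, -, hie⟩ := bracket_spec p hA hK hres hC S q.out
    refine IsIntegral.of_pow (Nat.pos_of_ne_zero (index_posPrincipal_ne_zero hA hK S)) ?_
    change IsIntegral K (S.bracket C q.out ^ (S.posPrincipal A k).index)
    rw [hie]
    exact isIntegral_algebraMap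
  refine finiteDimensional_of_le (F := IntermediateField.adjoin K T)
    (IntermediateField.adjoin_le_iff.mpr ?_)
  rintro _ ⟨I, rfl⟩
  obtain ⟨a, ha, hI⟩ := exists_mul_toPrincipalIdeal (S := S) (I := I)
    (J := (QuotientGroup.mk I : G).out) (QuotientGroup.out_eq' _).symm
  change S.bracket C I ∈ _
  rw [← hI, bracket_mul p hA hK hres hC S _ ha]
  exact mul_mem (IntermediateField.subset_adjoin _ _ ⟨_, rfl⟩)
    ((IntermediateField.adjoin K T).algebraMap_mem _)

theorem finiteDimensional_fieldInf (p : ℕ) [Fact p.Prime] [CharP Fr p]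
    (hA : IsAffineRingAway Fr A k inf)
    (hK : IsCompletionAt inf K)
    (hres : HasConstantResidues Fr K)
    (hC : IsCompletedAlgClosure K C) (S : SignData Fr K) {c : (Ideal A)⁰ → C}
    (hc : ∃ E : IntermediateField K C, FiniteDimensional K E ∧ ∀ I, c I ∈ E) :
    FiniteDimensional K (fieldInf k S c) := by
  obtain ⟨E, hE, hcE⟩ := hc
  have := finiteDimensional_adjoin_bracket p hA hK hres hC S
  refine finiteDimensional_of_le (F := IntermediateField.adjoin K
      (Set.range fun I : (FractionalIdeal A⁰ k)ˣ => S.bracket C I) ⊔ E) ?_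
  rw [fieldInf, IntermediateField.adjoin_union]
  refine sup_le_sup_left (IntermediateField.adjoin_le_iff.mpr ?_) _
  rintro _ ⟨I, rfl⟩
  exact hcE I

theorem finsum_mem_intermediateField {F L ι : Type*} [Field F] [Field L] [Algebra F L]
    (E : IntermediateField F L) {s : Set ι} {f : ι → L} (h : ∀ i ∈ s, f i ∈ E) :
    ∑ᶠ i ∈ s, f i ∈ E :=
  finsum_mem_induction (· ∈ E) E.zero_mem (fun _ _ => E.add_mem) h

theorem coeffInf_mem (p : ℕ) [Fact p.Prime] [CharP Fr p]
    (hA : IsAffineRingAway Fr A k inf) (hK : IsCompletionAt inf K)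
    (hres : HasConstantResidues Fr K)
    (hC : IsCompletedAlgClosure K C) (S : SignData Fr K) {c : (Ideal A)⁰ → C}
    (hfin : FiniteDimensional K (fieldInf k S c)) (y : ℤ_[p]) (d : ℕ) :
    coeffInf k S c y d ∈ fieldInf k S c := by
  have := hC.ultrametric
  have := hC.complete
  have := hK.complete
  have : CharP K p := charP_of_injective_algebraMap (algebraMap Fr K).injective p
  have : CharP C p := charP_of_injective_algebraMap (algebraMap K C).injective p
  refine finsum_mem_intermediateField _ fun I _ => mul_mem ?_ ?_
  · exact IntermediateField.subset_adjoin _ _ (Or.inr ⟨I, rfl⟩)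
  · exact padicPow_mem p (isClosed_intermediateField (fieldInf k S c)) (fun x hx n => pow_mem hx n)
      (bracket_spec p hA hK hres hC S _).1
      (IntermediateField.subset_adjoin _ _ (Or.inl ⟨_, rfl⟩)) _

end Bracket

/-! ### The finite places -/

section FinitePlace

variable {Fr A k K C : Type*} [Field Fr] [Finite Fr] [CommRing A] [IsDedekindDomain A]
  [Field k] [Algebra Fr A] [Algebra A k] [Algebra Fr k] [IsScalarTower Fr A k]
  [IsFractionRing A k] {inf : ValuationSubring k} [NontriviallyNormedField K] [Algebra k K]
  [Algebra Fr K] [IsScalarTower Fr k K] [NormedField C] [NormedAlgebra K C]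
  [Algebra k C] [IsScalarTower k K C]

/-- The `e`-th power of `I_1 = π_* ^ (-deg I) ⟨I⟩` is the positive generator of `I ^ e`: by the
product formula, the power of `π` in `⟨I⟩ ^ e` cancels against `π_* ^ (-e * deg I)`. -/
theorem idealValue_pow (p : ℕ) [Fact p.Prime] [CharP Fr p]
    (hA : IsAffineRingAway Fr A k inf) (hK : IsCompletionAt inf K)
    (hres : HasConstantResidues Fr K)
    (hC : IsCompletedAlgClosure K C) (S : SignData Fr K) {πs : C}
    (hπs : πs ^ degInf Fr K = algebraMap K C S.π) (I : (Ideal A)⁰) :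
    ∃ (i : kˣ) (a : A), S.sgnOn k i = 1 ∧
      toPrincipalIdeal A k i = FractionalIdeal.mk0 k I ^ (S.posPrincipal A k).index ∧
      algebraMap A k a = i ∧ Ideal.span {a} = (I : Ideal A) ^ (S.posPrincipal A k).index ∧
      idealValue k S πs I ^ (S.posPrincipal A k).index = algebraMap k C i := by
  obtain ⟨-, i, hi, hiI, hie⟩ := bracket_spec p hA hK hres hC S (FractionalIdeal.mk0 k I)
  set e := (S.posPrincipal A k).index with he
  have hspan : FractionalIdeal.spanSingleton A⁰ (i : k) =
      (((I : Ideal A) ^ e : Ideal A) : FractionalIdeal A⁰ k) := by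
    rw [toPrincipalIdeal_eq_iff] at hiI
    rw [hiI, FractionalIdeal.coeIdeal_pow]
    simp
  obtain ⟨a, ha⟩ : ∃ a : A, algebraMap A k a = i := by
    have h1 : (i : k) ∈ (((I : Ideal A) ^ e : Ideal A) : FractionalIdeal A⁰ k) :=
      hspan ▸ FractionalIdeal.mem_spanSingleton_self _ _
    obtain ⟨a, -, ha⟩ := (FractionalIdeal.mem_coeIdeal A⁰).mp h1
    exact ⟨a, ha⟩
  have hspanA : Ideal.span {a} = (I : Ideal A) ^ e := by
    apply FractionalIdeal.coeIdeal_injective (K := k)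
    beta_reduce
    rw [FractionalIdeal.coeIdeal_span_singleton, ha, hspan]
  refine ⟨i, a, hi, hiI, ha, hspanA, ?_⟩
  have ha0 : a ≠ 0 := by rintro rfl; exact i.ne_zero (by rw [← ha, map_zero])
  obtain ⟨v, hv⟩ := exists_normInf_eq_pow hA hK S ha0
  have hdeg : e * ideg Fr I = v * degInf Fr K := by
    rw [← (finrank_quotient_span hA hK hres S hv).2, hspanA,
      finrank_quotient_pow hA hK hres S (nonZeroDivisors.ne_zero I.2), ideg]
  have hord : S.ord (toK K i) = -(v : ℤ) := S.ord_eq_of_norm_eq (by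
    rw [zpow_neg, ← inv_zpow, zpow_natCast, ← hv, normInf, ha]; rfl)
  have hπ : algebraMap K C S.π ≠ 0 := by simp
  have hangle : algebraMap K C (S.angle (toK K i) : Kˣ) =
      algebraMap K C S.π ^ v * algebraMap k C i := by
    rw [SignData.angle, hord, neg_neg, zpow_natCast, IsScalarTower.algebraMap_apply k K C,
      ← map_pow, ← map_mul]
    rfl
  rw [idealValue, mul_pow, hie, hangle, ← pow_mul, mul_comm _ e, hdeg, ← hπs, ← pow_mul,
    mul_comm v, inv_pow, inv_mul_cancel_left₀]
  rw [pow_mul, hπs]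
  exact pow_ne_zero _ hπ

variable {Cv : Type*} [NormedField Cv] [Algebra k Cv]

theorem transport_eq (τ : algebraicClosure k C →ₐ[k] Cv) {z : C} (h : z ∈ algebraicClosure k C) :
    transport τ z = τ ⟨z, h⟩ := by
  rw [transport, dif_pos h]

theorem transport_idealValue (p : ℕ) [Fact p.Prime] [CharP Fr p]
    (hA : IsAffineRingAway Fr A k inf) (hK : IsCompletionAt inf K)
    (hres : HasConstantResidues Fr K)
    (hC : IsCompletedAlgClosure K C) (S : SignData Fr K) {πs : C}
    (hπs : πs ^ degInf Fr K = algebraMap K C S.π) (τ : algebraicClosure k C →ₐ[k] Cv)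
    (I : (Ideal A)⁰) :
    ∃ (i : kˣ) (a : A), S.sgnOn k i = 1 ∧
      toPrincipalIdeal A k i = FractionalIdeal.mk0 k I ^ (S.posPrincipal A k).index ∧
      algebraMap A k a = i ∧ Ideal.span {a} = (I : Ideal A) ^ (S.posPrincipal A k).index ∧
      transport τ (idealValue k S πs I) ^ (S.posPrincipal A k).index = algebraMap k Cv i := by
  obtain ⟨i, a, hi, hiI, ha, hspan, h⟩ := idealValue_pow p hA hK hres hC S hπs I
  refine ⟨i, a, hi, hiI, ha, hspan, ?_⟩
  have hmem : idealValue k S πs I ∈ algebraicClosure k C := by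
    rw [mem_algebraicClosure_iff]
    refine IsAlgebraic.of_pow (Nat.pos_of_ne_zero (index_posPrincipal_ne_zero hA hK S)) ?_
    rw [h]
    exact isAlgebraic_algebraMap _
  rw [transport_eq τ hmem, ← map_pow, ← τ.commutes]
  congr 1
  exact Subtype.ext h

variable {Kv : Type*} [NontriviallyNormedField Kv] [Algebra k Kv] [NormedAlgebra Kv Cv]
  [IsScalarTower k Kv Cv]

/-- The values `τ(I_1)` and the coefficients `τ(c(I))` generate a finite extension of `k_v`: if
`I = J (a)` with `a` positive, then `τ(I_1)` and `a τ(J_1)` differ by an `e`-th root of unity. -/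
theorem finiteDimensional_fieldFin (p : ℕ) [Fact p.Prime] [CharP Fr p]
    (hA : IsAffineRingAway Fr A k inf) (hK : IsCompletionAt inf K)
    (hres : HasConstantResidues Fr K)
    (hC : IsCompletedAlgClosure K C) (S : SignData Fr K) {πs : C}
    (hπs : πs ^ degInf Fr K = algebraMap K C S.π) (τ : algebraicClosure k C →ₐ[k] Cv)
    {c : (Ideal A)⁰ → C}
    (hc : ∃ E : IntermediateField k C, FiniteDimensional k E ∧ ∀ I, c I ∈ E) :
    FiniteDimensional Kv (fieldFin k Kv S πs τ c) := by
  obtain ⟨E, hE, hcE⟩ := hc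
  set e := (S.posPrincipal A k).index with he
  have he0 : e ≠ 0 := index_posPrincipal_ne_zero hA hK S
  have hfin : (S.posPrincipal A k).FiniteIndex := ⟨he0⟩
  let G := (FractionalIdeal A⁰ k)ˣ ⧸ S.posPrincipal A k
  have : Finite G := Subgroup.finite_quotient_of_finiteIndex
  let f : (Ideal A)⁰ → G := fun I => QuotientGroup.mk (FractionalIdeal.mk0 k I)
  let w : (Ideal A)⁰ → Cv := fun I => transport τ (idealValue k S πs I)
  have hEle : E ≤ algebraicClosure k C := fun x hx => mem_algebraicClosure_iff.mpr
    ((Algebra.IsAlgebraic.isAlgebraic (R := k) (⟨x, hx⟩ : E)).algHom E.val)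
  let σ : E →ₐ[k] Cv := τ.comp (IntermediateField.inclusion hEle)
  have hσ : ∀ x : E, transport τ (x : C) = σ x := fun x => transport_eq τ (hEle x.2)
  -- generators: one value for each class of ideals, the `e`-th roots of unity, and the image
  -- of a basis of the field `E` containing the coefficients
  let T₁ : Set Cv := Set.range fun q : G => w (Function.invFun f q)
  let T₂ : Set Cv := (nthRootsFinset e (1 : Cv) : Set Cv)
  let T₃ : Set Cv := Set.range fun j => σ (Module.finBasis k E j)
  let T := T₁ ∪ T₂ ∪ T₃
  have hTfin : Finite T :=
    ((Set.finite_range _).union (Finset.finite_toSet _)).union (Set.finite_range _)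
  have hT : FiniteDimensional Kv (IntermediateField.adjoin Kv T) := by
    refine IntermediateField.finiteDimensional_adjoin ?_
    rintro x ((⟨q, rfl⟩ | hx) | ⟨j, rfl⟩)
    · obtain ⟨i, -, -, -, -, -, h⟩ := transport_idealValue p hA hK hres hC S hπs τ
        (Function.invFun f q)
      refine IsIntegral.of_pow (Nat.pos_of_ne_zero he0) ?_
      change IsIntegral Kv (transport τ (idealValue k S πs _) ^ e)
      rw [h, IsScalarTower.algebraMap_apply k Kv Cv]
      exact isIntegral_algebraMap
    · refine IsIntegral.of_pow (Nat.pos_of_ne_zero he0) ?_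
      rw [(mem_nthRootsFinset (Nat.pos_of_ne_zero he0) 1).mp hx]
      exact isIntegral_one
    · have h1 : IsIntegral k (σ (Module.finBasis k E j)) :=
        (Algebra.IsIntegral.isIntegral (R := k) (Module.finBasis k E j)).map σ
      exact h1.tower_top
  refine finiteDimensional_of_le (F := IntermediateField.adjoin Kv T)
    (IntermediateField.adjoin_le_iff.mpr ?_)
  have hk : ∀ x : k, algebraMap k Cv x ∈ IntermediateField.adjoin Kv T := fun x => by
    rw [IsScalarTower.algebraMap_apply k Kv Cv]
    exact (IntermediateField.adjoin Kv T).algebraMap_mem _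
  rintro _ (⟨I, rfl⟩ | ⟨I, rfl⟩)
  · set J := Function.invFun f (f I) with hJ
    have hfJ : f J = f I := Function.invFun_eq ⟨I, rfl⟩
    obtain ⟨a, ha, hI⟩ := exists_mul_toPrincipalIdeal (S := S) hfJ.symm
    obtain ⟨i, -, hi, hiI, -, -, hie⟩ := transport_idealValue p hA hK hres hC S hπs τ I
    obtain ⟨j, -, hj, hjJ, -, -, hje⟩ := transport_idealValue p hA hK hres hC S hπs τ J
    have hij : i = j * a ^ e := eq_of_toPrincipalIdeal_eq hA hK hres S hi
      (by rw [map_mul, map_pow, hj, ha, one_pow, one_mul])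
      (by rw [hiI, map_mul, map_pow, hjJ, ← mul_pow, hI])
    change w I ∈ _
    have hJ0 : w J ≠ 0 := fun h => by
      rw [show transport τ (idealValue k S πs J) = w J from rfl, h, zero_pow he0] at hje
      exact j.ne_zero ((map_eq_zero _).mp hje.symm)
    have ha0 : algebraMap k Cv a ≠ 0 := by simp
    have hζ : (w I / (algebraMap k Cv a * w J)) ^ e = 1 := by
      rw [div_pow, div_eq_one_iff_eq (pow_ne_zero _ (mul_ne_zero ha0 hJ0)), mul_pow]
      change transport τ (idealValue k S πs I) ^ e =
        _ * transport τ (idealValue k S πs J) ^ e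
      rw [hie, hje, hij, Units.val_mul, Units.val_pow_eq_pow_val, map_mul, map_pow, mul_comm]
    have hmemζ : w I / (algebraMap k Cv a * w J) ∈ IntermediateField.adjoin Kv T :=
      IntermediateField.subset_adjoin _ _
        (Or.inl (Or.inr ((mem_nthRootsFinset (Nat.pos_of_ne_zero he0) 1).mpr hζ)))
    have hmemJ : w J ∈ IntermediateField.adjoin Kv T :=
      IntermediateField.subset_adjoin _ _ (Or.inl (Or.inl ⟨f I, rfl⟩))
    have h1 := mul_mem hmemζ (mul_mem (hk a) hmemJ)
    rwa [div_mul_cancel₀ _ (mul_ne_zero ha0 hJ0)] at h1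
  · change transport τ (c I) ∈ _
    rw [hσ ⟨c I, hcE I⟩, ← (Module.finBasis k E).sum_repr ⟨c I, hcE I⟩, map_sum]
    refine sum_mem fun j _ => ?_
    rw [map_smul, Algebra.smul_def]
    exact mul_mem (hk _) (IntermediateField.subset_adjoin _ _ (Or.inr ⟨j, rfl⟩))

theorem norm_lt_one_of_mem {v : IsDedekindDomain.HeightOneSpectrum A}
    (hKv : IsCompletionAt (v.valuation k).valuationSubring Kv) {a : A} (ha : a ∈ v.asIdeal) :
    ‖algebraMap k Kv (algebraMap A k a)‖ < 1 := by
  by_cases ha0 : a = 0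
  · simp [ha0]
  have h0 : algebraMap k Kv (algebraMap A k a) ≠ 0 := by simpa using ha0
  have h1 : v.valuation k (algebraMap A k a) < 1 := by
    rw [IsDedekindDomain.HeightOneSpectrum.valuation_lt_one_iff_mem]
    exact ha
  have hv0 : v.valuation k (algebraMap A k a) ≠ 0 := by simpa using ha0
  rw [← one_lt_inv₀ (norm_pos_iff.mpr h0), ← norm_inv, ← map_inv₀, ← not_le, hKv.norm_le_one_iff,
    Valuation.mem_valuationSubring_iff, map_inv₀, not_le]
  exact (one_lt_inv₀ (zero_lt_iff.mpr hv0)).mpr h1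

/-- For `I` prime to `v` the value `τ(I_1)` has a Teichmüller representative. -/
theorem teich_spec (p : ℕ) [Fact p.Prime] [CharP Fr p]
    (hA : IsAffineRingAway Fr A k inf) (hK : IsCompletionAt inf K)
    (hres : HasConstantResidues Fr K)
    (hC : IsCompletedAlgClosure K C) (S : SignData Fr K) {πs : C}
    (hπs : πs ^ degInf Fr K = algebraMap K C S.π)
    {v : IsDedekindDomain.HeightOneSpectrum A}
    (hKv : IsCompletionAt (v.valuation k).valuationSubring Kv)
    (hCv : IsCompletedAlgClosure Kv Cv) (τ : algebraicClosure k C →ₐ[k] Cv)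
    {I : (Ideal A)⁰} (hI : ¬ (I : Ideal A) ≤ v.asIdeal) :
    (∃ n : ℕ, 0 < n ∧ teich (transport τ (idealValue k S πs I)) ^ n = 1) ∧
      ‖transport τ (idealValue k S πs I) - teich (transport τ (idealValue k S πs I))‖ < 1 := by
  have := hCv.algClosed
  refine Classical.epsilon_spec (p := fun ω : Cv => (∃ n : ℕ, 0 < n ∧ ω ^ n = 1) ∧
    ‖transport τ (idealValue k S πs I) - ω‖ < 1) ?_
  obtain ⟨i, a, -, -, ha, hspan, hie⟩ := transport_idealValue p hA hK hres hC S hπs τ I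
  set e := (S.posPrincipal A k).index with he
  have he0 : e ≠ 0 := index_posPrincipal_ne_zero hA hK S
  have hprime : v.asIdeal.IsPrime := v.isPrime
  have hav : a ∉ v.asIdeal := fun h => by
    have h1 : (I : Ideal A) ^ e ≤ v.asIdeal := by
      rw [← hspan]; exact (Ideal.span_singleton_le_iff_mem _).mpr h
    exact hI (hprime.le_of_pow_le h1)
  -- the residue field of `v` is finite
  obtain ⟨m, hm, ham⟩ : ∃ m : ℕ, m ≠ 0 ∧ a ^ m - 1 ∈ v.asIdeal := by
    have hmax : v.asIdeal.IsMaximal := v.isMaximal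
    have := finite_quotient hA hK hres S v.ne_bot
    have : Finite (A ⧸ v.asIdeal) := Module.finite_of_finite Fr
    let _ : Field (A ⧸ v.asIdeal) := Ideal.Quotient.field v.asIdeal
    have ha0 : Ideal.Quotient.mk v.asIdeal a ≠ 0 := fun h =>
      hav (Ideal.Quotient.eq_zero_iff_mem.mp h)
    obtain ⟨m, hm, h1⟩ := isOfFinOrder_iff_pow_eq_one.mp
      (isOfFinOrder_of_finite (Units.mk0 _ ha0))
    refine ⟨m, hm.ne', Ideal.Quotient.eq.mp ?_⟩
    have := congrArg Units.val h1
    simpa using this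
  have hsmall := norm_lt_one_of_mem (k := k) hKv ham
  set w := transport τ (idealValue k S πs I) with hw
  have hem : e * m ≠ 0 := mul_ne_zero he0 hm
  obtain ⟨ω, hω, hlt⟩ := exists_root_norm_sub_lt (P := X ^ (e * m) - Polynomial.C (1 : Cv))
    (monic_X_pow_sub_C 1 hem) (x := w) (by
      rw [eval_sub, eval_pow, eval_X, eval_C, pow_mul, hie, ← ha,
        IsScalarTower.algebraMap_apply k Kv Cv, ← map_pow, ← map_pow, ← map_pow,
        ← map_one (algebraMap Kv Cv), ← map_sub, norm_algebraMap', ← map_one (algebraMap k Kv),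
        ← map_sub, ← map_one (algebraMap A k), ← map_sub]
      exact hsmall)
  exact ⟨ω, ⟨e * m, Nat.pos_of_ne_zero hem, by simpa [sub_eq_zero] using hω⟩, hlt⟩

theorem coeffFin_mem (p : ℕ) [Fact p.Prime] [CharP Fr p]
    (hA : IsAffineRingAway Fr A k inf) (hK : IsCompletionAt inf K)
    (hres : HasConstantResidues Fr K)
    (hC : IsCompletedAlgClosure K C) (S : SignData Fr K) {πs : C}
    (hπs : πs ^ degInf Fr K = algebraMap K C S.π)
    {v : IsDedekindDomain.HeightOneSpectrum A}
    (hKv : IsCompletionAt (v.valuation k).valuationSubring Kv)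
    (hCv : IsCompletedAlgClosure Kv Cv) (τ : algebraicClosure k C →ₐ[k] Cv)
    {c : (Ideal A)⁰ → C} (hfin : FiniteDimensional Kv (fieldFin k Kv S πs τ c))
    (j : ℤ) (y : ℤ_[p]) (d : ℕ) :
    coeffFin k S πs v τ c j y d ∈ fieldFin k Kv S πs τ c := by
  have := hCv.ultrametric
  have := hCv.complete
  have := hKv.complete
  have : CharP k p := charP_of_injective_algebraMap (algebraMap Fr k).injective p
  have : CharP Cv p := charP_of_injective_algebraMap (algebraMap k Cv).injective p
  have hcl := isClosed_intermediateField (fieldFin k Kv S πs τ c)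
  refine finsum_mem_intermediateField _ fun I hI => mul_mem ?_ ?_
  · exact IntermediateField.subset_adjoin _ _ (Or.inr ⟨I, rfl⟩)
  obtain ⟨⟨n, hn, hωn⟩, hlt⟩ := teich_spec p hA hK hres hC S hπs hKv hCv τ hI.2
  rw [unitPow]
  set w := transport τ (idealValue k S πs I) with hw
  have hwmem : w ∈ fieldFin k Kv S πs τ c :=
    IntermediateField.subset_adjoin _ _ (Or.inl ⟨I, rfl⟩)
  have hω : teich w ∈ fieldFin k Kv S πs τ c :=
    rootOfUnity_mem p hcl (fun x hx n => pow_mem hx n) hwmem hlt hn.ne' hωn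
  have hω1 : ‖teich w‖ = 1 :=
    (pow_eq_one_iff_of_nonneg (norm_nonneg _) hn.ne').mp (by rw [← norm_pow, hωn, norm_one])
  have hω0 : teich w ≠ 0 := norm_pos_iff.mp (by rw [hω1]; exact one_pos)
  refine mul_mem (zpow_mem hω _) (padicPow_mem p hcl (fun x hx n => pow_mem hx n) ?_
    (div_mem hwmem hω) _)
  rw [div_sub_one hω0, norm_div, hω1, div_one]
  exact hlt

end FinitePlace

end CharPL

end

theorem proposition2p11
    -- the prime `p`, the finite field `Fr`, the curve, the place `∞` and the ring `A`
    {p : ℕ} [Fact p.Prime]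
    {Fr A k : Type*} [Field Fr] [Finite Fr] [CharP Fr p]
    [CommRing A] [IsDedekindDomain A] [Field k]
    [Algebra Fr A] [Algebra A k] [Algebra Fr k] [IsScalarTower Fr A k] [IsFractionRing A k]
    (inf : ValuationSubring k) (hA : CharPL.IsAffineRingAway Fr A k inf)
    -- the completion `K` at `∞` and the completed algebraic closure `C`
    {K C : Type*} [NontriviallyNormedField K] [Algebra k K] [Algebra Fr K] [IsScalarTower Fr k K]
    (hK : CharPL.IsCompletionAt inf K)
    [NormedField C] [NormedAlgebra K C] [Algebra k C] [IsScalarTower k K C]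
    (hC : CharPL.IsCompletedAlgClosure K C)
    -- the sign function and the positive uniformizer
    (S : CharPL.SignData Fr K)
    -- the coefficients of the Dirichlet series `L(s)`
    (c : (Ideal A)⁰ → C) :
    -- the place `∞`
    ((∃ E : IntermediateField K C, FiniteDimensional K E ∧ ∀ I, c I ∈ E) →
      (∀ y : ℤ_[p], CharPL.IsEntire (CharPL.coeffInf k S c y)) →
      ∀ (y : ℤ_[p]) (b : ℝ), CharPL.IsGRHBound (CharPL.coeffInf k S c y) b →
        (∀ β : C, CharPL.IsZeroOf (CharPL.coeffInf k S c y) β → b < 1 / ‖β‖ →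
          CharPL.TotallyInseparable (CharPL.fieldInf k S c) β) ∧
        CharPL.FiniteSeparablePart (CharPL.fieldInf k S c) (CharPL.coeffInf k S c y)) ∧
    -- the finite places `v`
    (∀ (v : IsDedekindDomain.HeightOneSpectrum A)
      {Kv Cv : Type*} [NontriviallyNormedField Kv] [Algebra k Kv] [NormedField Cv]
      [NormedAlgebra Kv Cv] [Algebra k Cv] [IsScalarTower k Kv Cv]
      (_ : CharPL.IsCompletionAt (v.valuation k).valuationSubring Kv)
      (_ : CharPL.IsCompletedAlgClosure Kv Cv)
      (τ : algebraicClosure k C →ₐ[k] Cv)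
      (πs : C) (_ : πs ^ CharPL.degInf Fr K = algebraMap K C S.π),
      (∃ E : IntermediateField k C, FiniteDimensional k E ∧ ∀ I, c I ∈ E) →
      (∀ (j : ℤ) (y : ℤ_[p]), CharPL.IsEntire (CharPL.coeffFin k S πs v τ c j y)) →
      ∀ (j : ℤ) (y : ℤ_[p]) (b : ℝ), CharPL.IsGRHBound (CharPL.coeffFin k S πs v τ c j y) b →
        (∀ β : Cv, CharPL.IsZeroOf (CharPL.coeffFin k S πs v τ c j y) β → b < 1 / ‖β‖ →
          CharPL.TotallyInseparable (CharPL.fieldFin k Kv S πs τ c) β) ∧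
        CharPL.FiniteSeparablePart (CharPL.fieldFin k Kv S πs τ c)
          (CharPL.coeffFin k S πs v τ c j y)) := by
  have : CharP K p := charP_of_injective_algebraMap (algebraMap Fr K).injective p
  have : CharP C p := charP_of_injective_algebraMap (algebraMap K C).injective p
  have := hK.complete
  have hres : CharPL.HasConstantResidues Fr K :=
    CharPL.hasConstantResidues p hA hK hC
  constructor
  · intro hc hent y b hb
    have := hC.complete
    have := hC.ultrametric
    have := hC.algClosed
    have hfin := CharPL.finiteDimensional_fieldInf p hA hK hres hC S hc
    exact CharPL.totallyInseparable_and_finiteSeparablePart (CharPL.fieldInf k S c)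
      (CharPL.coeffInf_mem p hA hK hres hC S hfin y) (hent y) hb
  · intro v Kv Cv _ _ _ _ _ _ hKv hCv τ πs hπs hc hent j y b hb
    have := hKv.complete
    have := hCv.complete
    have := hCv.ultrametric
    have := hCv.algClosed
    have hfin : FiniteDimensional Kv (CharPL.fieldFin k Kv S πs τ c) :=
      CharPL.finiteDimensional_fieldFin p hA hK hres hC S hπs τ hc
    exact CharPL.totallyInseparable_and_finiteSeparablePart (CharPL.fieldFin k Kv S πs τ c)
      (CharPL.coeffFin_mem p hA hK hres hC S hπs hKv hCv τ hfin j y) (hent j y) hb
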